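/- **Types and terms.** Types are $\tau,\sigma ::= \mathbb B\mid\mathbb N\mid \mathsf{list}\,\tau\mid\tau\times\sigma\mid\tau\to\sigma$. Terms are $$t ::= x\mid\langle t,t\rangle\mid\pi_1 t\mid\pi_2 t\mid t\,t\mid\lambda x{:}\tau.t\mid \mathsf{tt}\mid\mathsf{ff}\mid 0\mid[\,]\mid S\,t\mid t::t\mid \mathsf{case}\,t\,\mathsf{of}\,[\mathsf{tt}\mapsto u;\mathsf{ff}\mapsto v]\mid\mathsf{case}\,t\,\mathsf{of}\,[0\mapsto u;S\mapsto v]\mid\mathsf{case}\,t\,\mathsf{of}\,[[\,]\mapsto u;\_::\_\mapsto v]\mid\mathsf{letrec}\,f\,x=e,$$ with the standard simple typing rules $\Gamma\vdash t:\tau$ (in the last two cases $v$ is a function of the components of the constructor). For recursive definitions the rule is: $\Gamma\vdash(\mathsf{letrec}\,f\,x=e):I\to\sigma$ if $I$ is $\mathbb N$ or $\mathsf{list}\,\tau$, $\Gamma,f{:}I\to\sigma,x{:}I\vdash e:\sigma$, and $\mathrm{Def}(f,x,e)$, where $\mathrm{Def}(f,x,e)$ says that recursive calls are on strictly smaller arguments: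 for every valuation of $\Gamma$, the value of $e$ at an argument $v$ depends on the function $f$ only through its values at arguments $m$ with $|m|<|v|$ ($|n|=n$ on $\mathbb N$; $|l|$ is the length of $l$). **Semantics.** $[\![\mathbb B]\!]$, $[\![\mathbb N]\!]$ are the booleans and the natural numbers, $[\![\mathsf{list}\,\tau]\!]$ the finite lists over $[\![\tau]\!]$, $[\![\sigma\times\tau]\!]=[\![\sigma]\!]\times[\![\tau]\!]$ and $[\![\sigma\to\tau]\!]$ is the set of all functions $[\![\sigma]\!]\to[\![\tau]\!]$. A valuation $\rho\models\Gamma$ assigns to each $x{:}\tau$ in $\Gamma$ an element of $[\![\tau]\!]$. Terms are interpreted in the usual way; $[\![\mathsf{letrec}\,f\,x=e]\!]_\rho$ is the unique function $F$ with $F(v)=[\![e]\!]_{\rho[F/f][v/x]}$ for all $v$. **Assertions.** $\phi ::= P(t_1,\dots,t_n)\mid t=u\mid |t|<|u|\mid|t|\le|u|\mid\top\mid\bot\mid\phi\wedge\phi\mid\phi\vee\phi\mid\phi\Rightarrow\phi\mid\forall x{:}\tau.\phi\mid\exists x{:}\tau.\phi$ over well-typed terms. $P$ ranges over an arbitrary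 signature of typed basic predicates, which come with an arbitrary set of closed axioms. An interpretation $[\![P]\!]\subseteq[\![\tau_1]\!]\times\cdots\times[\![\tau_n]\!]$ of each $P:\tau_1\times\dots\times\tau_n$, under which all the axioms are true, is fixed, and $[\![\phi]\!]_\rho$ is the usual truth value. **Logics.** *HOL* judgments $\Gamma\mid\Psi\vdash\phi$ are derived by natural deduction for $\top,\bot,\wedge,\vee,\Rightarrow,\forall,\exists$, the hypothesis rule, the axioms of the basic predicates, $\Gamma\mid\Psi\vdash t=u$ for convertible well-typed $t=_{\beta\iota\mu}u$ of the same type, substitution of equals, structural induction on $\mathbb B$, $\mathbb N$ and lists, strong induction on size over $\mathbb N$ and lists, and disjointness and injectivity of constructors. Here $\beta\iota\mu$-reduction consists of $\beta$-reduction, projections of pairs, case analysis on constructors, and unfolding of $\mathsf{letrec}$ applied to a term with a constructor in head position. *UHOL* judgments $\Gamma\mid\Psi\vdash t:\tau\mid\phi$, with $\phi$ in the context $\Gamma,\mathbf r{:}\tau$, are derived by the syntax-directed rules for variables, constants, $S$, $::$, abstraction, application, pairs, projections, case and $\mathsf{letrec}$, and subsumption (from $\phi'$ infer $\phi$ if $\Gamma\mid\Psi\vdash\phi'[t/\mathbf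 r]\Rightarrow\phi[t/\mathbf r]$ in HOL). *RHOL* judgments $\Gamma\mid\Psi\vdash t_1:\sigma_1\sim t_2:\sigma_2\mid\phi$, with $\Gamma\vdash t_i:\sigma_i$, $\Psi$ a set of assertions in $\Gamma$ and $\phi$ an assertion in $\Gamma,\mathbf r_1{:}\sigma_1,\mathbf r_2{:}\sigma_2$, are derived by: the two-sided rules, which relate two terms with the same head construct (for instance, from $\Gamma,x_1{:}\tau_1,x_2{:}\tau_2\mid\Psi,\phi'\vdash t_1:\sigma_1\sim t_2:\sigma_2\mid\phi$ infer $\Gamma\mid\Psi\vdash\lambda x_1.t_1:\tau_1\to\sigma_1\sim\lambda x_2.t_2:\tau_2\to\sigma_2\mid\forall x_1x_2.\,\phi'\Rightarrow\phi[\mathbf r_1x_1/\mathbf r_1][\mathbf r_2x_2/\mathbf r_2]$); the one-sided rules, left and right, which analyse one of the two terms only; synchronous, one-sided, asynchronous and alternative case rules; two-sided and one-sided $\mathsf{letrec}$ rules, by strong induction on the sizes of the arguments (for two arguments, $(a,b)<(c,d)$ iff $a\le c$, $b\le d$ and one of these is strict); subsumption discharged in HOL; introduction of $\wedge$ and $\Rightarrow$;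 and, for falling back to UHOL, the rule that infers the judgment above from $\Gamma\mid\Psi\vdash t_1:\sigma_1\mid\phi[\mathbf r/\mathbf r_1][t_2/\mathbf r_2]$, and its mirror image. **Corollary (set-theoretical soundness and consistency of RHOL).** If $\Gamma\mid\Psi\vdash t_1:\sigma_1\sim t_2:\sigma_2\mid\phi$ is derivable in RHOL, then for every valuation $\rho\models\Gamma$ such that $[\![\psi]\!]_\rho$ holds for all $\psi\in\Psi$, the assertion $\phi$ holds under the extended valuation $$\rho\big[[\![t_1]\!]_\rho/\mathbf r_1\big]\big[[\![t_2]\!]_\rho/\mathbf r_2\big].$$ In particular, $\Gamma\mid\emptyset\vdash t_1:\sigma_1\sim t_2:\sigma_2\mid\bot$ is not derivable, for any $\Gamma$, $\sigma_1,\sigma_2$, $t_1,t_2$. -/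

import Mathlib

universe u

namespace RelHOL

/-! ### Types and their set-theoretic interpretation -/

/-- Simple types: booleans, naturals, lists, products and arrows. -/
inductive Ty : Type
  | bool : Ty
  | nat : Ty
  | list : Ty → Ty
  | prod : Ty → Ty → Ty
  | arr : Ty → Ty → Ty

/-- The set `⟦τ⟧`; arrows are interpreted by all total functions. -/
abbrev Ty.Den : Ty → Type
  | .bool => Bool
  | .nat => ℕ
  | .list τ => List τ.Den
  | .prod σ τ => σ.Den × τ.Den
  | .arr σ τ => σ.Den → τ.Den

/-- Every `⟦τ⟧` has an element. -/
def Ty.someDen : (τ : Ty) → τ.Den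
  | .bool => false
  | .nat => 0
  | .list _ => []
  | .prod σ τ => (σ.someDen, τ.someDen)
  | .arr _ τ => fun _ => τ.someDen

/-- The inductive types that may be the domain of a recursive definition. -/
inductive IsInd : Ty → Prop
  | nat : IsInd .nat
  | list (τ : Ty) : IsInd (.list τ)

/-- The size of a natural number is the number itself, that of a list is its length
(only used at the types `IsInd`). -/
def Ty.size : (τ : Ty) → τ.Den → ℕ
  | .nat, n => n
  | .list _, l => l.length
  | _, _ => 0

/-- Contexts, in de Bruijn style: the head is the most recently declared variable. -/
abbrev Ctx := List Ty

/-- `Var Γ τ`: the variables declared with type `τ` in `Γ`. -/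
inductive Var : Ctx → Ty → Type
  | z {Γ : Ctx} {τ : Ty} : Var (τ :: Γ) τ
  | s {Γ : Ctx} {σ τ : Ty} : Var Γ τ → Var (σ :: Γ) τ

/-- A valuation of `Γ` maps each variable declared in `Γ` to an element of the
interpretation of its type. -/
def Env (Γ : Ctx) : Type := ∀ τ, Var Γ τ → τ.Den

/-- The valuation of the empty context. -/
def Env.nil : Env [] := fun _ x => nomatch x

/-- Extension of a valuation by a value for a new variable. -/
def Env.cons {Γ : Ctx} {σ : Ty} (v : σ.Den) (ρ : Env Γ) : Env (σ :: Γ) := fun _ x =>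
  match x with
  | .z => v
  | .s y => ρ _ y

/-! ### Terms -/

/-- Simply typed terms, before the restriction on recursive definitions is imposed.
In `letrec h e` the body `e` has the argument `x` as variable `0` and the function `f` as
variable `1`. -/
inductive Tm : Ctx → Ty → Type
  | var {Γ : Ctx} {τ : Ty} : Var Γ τ → Tm Γ τ
  | pair {Γ : Ctx} {σ τ : Ty} : Tm Γ σ → Tm Γ τ → Tm Γ (.prod σ τ)
  | fst {Γ : Ctx} {σ τ : Ty} : Tm Γ (.prod σ τ) → Tm Γ σ
  | snd {Γ : Ctx} {σ τ : Ty} : Tm Γ (.prod σ τ) → Tm Γ τ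
  | app {Γ : Ctx} {σ τ : Ty} : Tm Γ (.arr σ τ) → Tm Γ σ → Tm Γ τ
  | lam {Γ : Ctx} {σ τ : Ty} : Tm (σ :: Γ) τ → Tm Γ (.arr σ τ)
  | tt {Γ : Ctx} : Tm Γ .bool
  | ff {Γ : Ctx} : Tm Γ .bool
  | zero {Γ : Ctx} : Tm Γ .nat
  | succ {Γ : Ctx} : Tm Γ .nat → Tm Γ .nat
  | nil {Γ : Ctx} {τ : Ty} : Tm Γ (.list τ)
  | cons {Γ : Ctx} {τ : Ty} : Tm Γ τ → Tm Γ (.list τ) → Tm Γ (.list τ)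
  | caseBool {Γ : Ctx} {σ : Ty} : Tm Γ .bool → Tm Γ σ → Tm Γ σ → Tm Γ σ
  | caseNat {Γ : Ctx} {σ : Ty} : Tm Γ .nat → Tm Γ σ → Tm Γ (.arr .nat σ) → Tm Γ σ
  | caseList {Γ : Ctx} {τ σ : Ty} :
      Tm Γ (.list τ) → Tm Γ σ → Tm Γ (.arr τ (.arr (.list τ) σ)) → Tm Γ σ
  | letrec {Γ : Ctx} {ι σ : Ty} :
      IsInd ι → Tm (ι :: .arr ι σ :: Γ) σ → Tm Γ (.arr ι σ)

open Classical in
/-- The unique `F` with `F v = G F v` for all `v`, and an irrelevant value if there is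
no such unique `F`. -/
noncomputable def uniqueFix {A : Type} {τ : Ty} (G : (A → τ.Den) → A → τ.Den) : A → τ.Den :=
  if h : ∃! F : A → τ.Den, ∀ v, F v = G F v then h.choose else fun _ => τ.someDen

/-- The interpretation `⟦t⟧ρ`. -/
noncomputable def Tm.den : {Γ : Ctx} → {τ : Ty} → Tm Γ τ → Env Γ → τ.Den
  | _, _, .var x, ρ => ρ _ x
  | _, _, .pair t u, ρ => (t.den ρ, u.den ρ)
  | _, _, .fst t, ρ => (t.den ρ).1
  | _, _, .snd t, ρ => (t.den ρ).2
  | _, _, .app t u, ρ => t.den ρ (u.den ρ)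
  | _, _, .lam t, ρ => fun v => t.den (Env.cons v ρ)
  | _, _, .tt, _ => true
  | _, _, .ff, _ => false
  | _, _, .zero, _ => (0 : ℕ)
  | _, _, .succ t, ρ => Nat.succ (t.den ρ)
  | _, _, .nil, _ => []
  | _, _, .cons t u, ρ => t.den ρ :: u.den ρ
  | _, _, .caseBool t u v, ρ =>
      match t.den ρ with
      | true => u.den ρ
      | false => v.den ρ
  | _, _, .caseNat t u v, ρ =>
      match t.den ρ with
      | Nat.zero => u.den ρ
      | Nat.succ n => v.den ρ n
  | _, _, .caseList t u v, ρ =>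
      match t.den ρ with
      | [] => u.den ρ
      | a :: l => v.den ρ a l
  | _, _, .letrec _ e, ρ => uniqueFix fun F v => e.den (Env.cons v (Env.cons F ρ))

/-- The predicate `Def(f, x, e)`: recursive calls are performed on strictly smaller arguments
only, i.e. the value of the body at an argument `v` depends on the function `f` only through
the values of `f` at arguments smaller than `v`. -/
def WellDef {Γ : Ctx} {ι σ : Ty} (e : Tm (ι :: .arr ι σ :: Γ) σ) : Prop :=
  ∀ (ρ : Env Γ) (v : ι.Den) (g g' : ι.Den → σ.Den),
    (∀ m : ι.Den, ι.size m < ι.size v → g m = g' m) →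
      e.den (Env.cons v (Env.cons (σ := .arr ι σ) g ρ)) =
        e.den (Env.cons v (Env.cons (σ := .arr ι σ) g' ρ))

/-- All recursive definitions in a term satisfy the predicate `WellDef`. -/
def Tm.Legal : {Γ : Ctx} → {τ : Ty} → Tm Γ τ → Prop
  | _, _, .var _ => True
  | _, _, .pair t u => t.Legal ∧ u.Legal
  | _, _, .fst t => t.Legal
  | _, _, .snd t => t.Legal
  | _, _, .app t u => t.Legal ∧ u.Legal
  | _, _, .lam t => t.Legal
  | _, _, .tt => True
  | _, _, .ff => True
  | _, _, .zero => True
  | _, _, .succ t => t.Legal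
  | _, _, .nil => True
  | _, _, .cons t u => t.Legal ∧ u.Legal
  | _, _, .caseBool t u v => t.Legal ∧ u.Legal ∧ v.Legal
  | _, _, .caseNat t u v => t.Legal ∧ u.Legal ∧ v.Legal
  | _, _, .caseList t u v => t.Legal ∧ u.Legal ∧ v.Legal
  | _, _, .letrec _ e => WellDef e ∧ e.Legal

/-- If recursive calls are on smaller arguments, the fixpoint equation has exactly one
solution. -/
theorem WellDef.existsUnique_fix {Γ : Ctx} {ι σ : Ty} {e : Tm (ι :: .arr ι σ :: Γ) σ}
    (h : WellDef e) (ρ : Env Γ) :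
    ∃! F : ι.Den → σ.Den, ∀ v, F v = e.den (Env.cons v (Env.cons (σ := .arr ι σ) F ρ)) := by
  classical
  let R : ι.Den → ι.Den → Prop := fun a b => ι.size a < ι.size b
  have hR : WellFounded R := (measure ι.size).wf
  let F : ι.Den → σ.Den := hR.fix fun v rec =>
    e.den (Env.cons v (Env.cons (σ := .arr ι σ)
      (fun m => if hm : R m v then rec m hm else σ.someDen) ρ))
  refine ⟨F, ?_, ?_⟩
  · intro v
    have h1 := hR.fix_eq (fun v rec => e.den (Env.cons v (Env.cons (σ := .arr ι σ)
      (fun m => if hm : R m v then rec m hm else σ.someDen) ρ))) v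
    refine h1.trans (h ρ v _ _ ?_)
    intro m hm
    have hm' : R m v := hm
    simp only [hm', dite_true]
    rfl
  · intro G hG
    funext v
    induction v using hR.induction with
    | _ v ih =>
      have h1 := hR.fix_eq (fun v rec => e.den (Env.cons v (Env.cons (σ := .arr ι σ)
        (fun m => if hm : R m v then rec m hm else σ.someDen) ρ))) v
      rw [hG v]
      refine Eq.trans (h ρ v _ _ ?_) h1.symm
      intro m hm
      have hm' : R m v := hm
      simp only [hm', dite_true]
      exact ih m hm'

/-! ### Substitution -/

/-- Renamings. -/
def Ren (Γ Δ : Ctx) : Type := ∀ τ, Var Γ τ → Var Δ τ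

/-- A renaming under a binder. -/
def Ren.lift {Γ Δ : Ctx} {σ : Ty} (r : Ren Γ Δ) : Ren (σ :: Γ) (σ :: Δ) := fun _ x =>
  match x with
  | .z => .z
  | .s y => .s (r _ y)

/-- Renaming of variables in a term. -/
def Tm.rename : {Γ Δ : Ctx} → {τ : Ty} → Tm Γ τ → Ren Γ Δ → Tm Δ τ
  | _, _, _, .var x, r => .var (r _ x)
  | _, _, _, .pair t u, r => .pair (t.rename r) (u.rename r)
  | _, _, _, .fst t, r => .fst (t.rename r)
  | _, _, _, .snd t, r => .snd (t.rename r)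
  | _, _, _, .app t u, r => .app (t.rename r) (u.rename r)
  | _, _, _, .lam t, r => .lam (t.rename r.lift)
  | _, _, _, .tt, _ => .tt
  | _, _, _, .ff, _ => .ff
  | _, _, _, .zero, _ => .zero
  | _, _, _, .succ t, r => .succ (t.rename r)
  | _, _, _, .nil, _ => .nil
  | _, _, _, .cons t u, r => .cons (t.rename r) (u.rename r)
  | _, _, _, .caseBool t u v, r => .caseBool (t.rename r) (u.rename r) (v.rename r)
  | _, _, _, .caseNat t u v, r => .caseNat (t.rename r) (u.rename r) (v.rename r)
  | _, _, _, .caseList t u v, r => .caseList (t.rename r) (u.rename r) (v.rename r)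
  | _, _, _, .letrec h e, r => .letrec h (e.rename r.lift.lift)

/-- Simultaneous substitutions. -/
def TmSub (Γ Δ : Ctx) : Type := ∀ τ, Var Γ τ → Tm Δ τ

/-- The identity substitution. -/
def TmSub.id {Γ : Ctx} : TmSub Γ Γ := fun _ x => .var x

/-- The substitution that sends variable `0` to `t` and the other variables as `θ` does. -/
def TmSub.cons {Γ Δ : Ctx} {σ : Ty} (t : Tm Δ σ) (θ : TmSub Γ Δ) : TmSub (σ :: Γ) Δ :=
  fun _ x =>
    match x with
    | .z => t
    | .s y => θ _ y

/-- A substitution under a binder. -/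
def TmSub.lift {Γ Δ : Ctx} {σ : Ty} (θ : TmSub Γ Δ) : TmSub (σ :: Γ) (σ :: Δ) :=
  TmSub.cons (.var .z) fun _ x => (θ _ x).rename fun _ => .s

/-- Capture-avoiding simultaneous substitution in a term. -/
def Tm.subst : {Γ Δ : Ctx} → {τ : Ty} → Tm Γ τ → TmSub Γ Δ → Tm Δ τ
  | _, _, _, .var x, θ => θ _ x
  | _, _, _, .pair t u, θ => .pair (t.subst θ) (u.subst θ)
  | _, _, _, .fst t, θ => .fst (t.subst θ)
  | _, _, _, .snd t, θ => .snd (t.subst θ)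
  | _, _, _, .app t u, θ => .app (t.subst θ) (u.subst θ)
  | _, _, _, .lam t, θ => .lam (t.subst θ.lift)
  | _, _, _, .tt, _ => .tt
  | _, _, _, .ff, _ => .ff
  | _, _, _, .zero, _ => .zero
  | _, _, _, .succ t, θ => .succ (t.subst θ)
  | _, _, _, .nil, _ => .nil
  | _, _, _, .cons t u, θ => .cons (t.subst θ) (u.subst θ)
  | _, _, _, .caseBool t u v, θ => .caseBool (t.subst θ) (u.subst θ) (v.subst θ)
  | _, _, _, .caseNat t u v, θ => .caseNat (t.subst θ) (u.subst θ) (v.subst θ)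
  | _, _, _, .caseList t u v, θ => .caseList (t.subst θ) (u.subst θ) (v.subst θ)
  | _, _, _, .letrec h e, θ => .letrec h (e.subst θ.lift.lift)

theorem Env.cons_rename {Γ Δ : Ctx} {σ : Ty} (r : Ren Γ Δ) (v : σ.Den) (ρ : Env Δ) :
    (fun τ x => Env.cons v ρ τ (r.lift τ x)) = Env.cons v (fun τ x => ρ τ (r τ x)) := by
  funext τ x
  cases x <;> rfl

theorem Tm.den_rename {Γ : Ctx} {τ : Ty} (t : Tm Γ τ) :
    ∀ {Δ : Ctx} (r : Ren Γ Δ) (ρ : Env Δ),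
      (t.rename r).den ρ = t.den (fun σ x => ρ σ (r σ x)) := by
  induction t <;> intro Δ r ρ <;> simp_all [Tm.rename, Tm.den, Env.cons_rename]

theorem Env.cons_subst {Γ Δ : Ctx} {σ : Ty} (θ : TmSub Γ Δ) (v : σ.Den) (ρ : Env Δ) :
    (fun τ x => (θ.lift τ x).den (Env.cons v ρ)) =
      Env.cons v (fun τ x => (θ τ x).den ρ) := by
  funext τ x
  cases x with
  | z => rfl
  | s y => exact Tm.den_rename (θ τ y) (fun _ => Var.s) (Env.cons v ρ)

theorem Tm.den_subst {Γ : Ctx} {τ : Ty} (t : Tm Γ τ) :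
    ∀ {Δ : Ctx} (θ : TmSub Γ Δ) (ρ : Env Δ),
      (t.subst θ).den ρ = t.den (fun σ x => (θ σ x).den ρ) := by
  induction t <;> intro Δ θ ρ <;> simp_all [Tm.subst, Tm.den, Env.cons_subst]

theorem Tm.Legal.rename {Γ : Ctx} {τ : Ty} (t : Tm Γ τ) :
    ∀ {Δ : Ctx} (r : Ren Γ Δ), t.Legal → (t.rename r).Legal := by
  induction t <;> intro Δ r h <;> simp_all [Tm.rename, Tm.Legal]
  intro ρ v g g' hg
  simpa only [Tm.den_rename, Env.cons_rename] using h.1 _ v g g' hg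

theorem TmSub.lift_legal {Γ Δ : Ctx} {σ : Ty} (θ : TmSub Γ Δ) (h : ∀ τ x, (θ τ x).Legal) :
    ∀ τ x, (TmSub.lift (σ := σ) θ τ x).Legal := by
  intro τ x
  cases x with
  | z => trivial
  | s y => exact Tm.Legal.rename _ _ (h _ y)

theorem Tm.Legal.subst {Γ : Ctx} {τ : Ty} (t : Tm Γ τ) :
    ∀ {Δ : Ctx} (θ : TmSub Γ Δ), (∀ σ x, (θ σ x).Legal) → t.Legal → (t.subst θ).Legal := by
  induction t <;> intro Δ θ hθ h
  case letrec hι e ih =>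
    refine ⟨?_, ih _ (TmSub.lift_legal _ (TmSub.lift_legal _ hθ)) h.2⟩
    intro ρ v g g' hg
    simpa only [Tm.den_subst, Env.cons_subst] using h.1 _ v g g' hg
  case lam t ih => exact ih _ (TmSub.lift_legal _ hθ) h
  all_goals simp_all [Tm.subst, Tm.Legal]

/-! ### Reduction -/

/-- Terms with a constructor in head position. -/
inductive Tm.IsCon : {Γ : Ctx} → {τ : Ty} → Tm Γ τ → Prop
  | tt {Γ : Ctx} : Tm.IsCon (.tt : Tm Γ _)
  | ff {Γ : Ctx} : Tm.IsCon (.ff : Tm Γ _)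
  | zero {Γ : Ctx} : Tm.IsCon (.zero : Tm Γ _)
  | succ {Γ : Ctx} (t : Tm Γ .nat) : Tm.IsCon (.succ t)
  | nil {Γ : Ctx} {τ : Ty} : Tm.IsCon (.nil : Tm Γ (.list τ))
  | cons {Γ : Ctx} {τ : Ty} (t : Tm Γ τ) (u : Tm Γ (.list τ)) : Tm.IsCon (.cons t u)

/-- One-step `βιμ`-reduction, closed under all term constructors. -/
inductive Step : {Γ : Ctx} → {τ : Ty} → Tm Γ τ → Tm Γ τ → Prop
  | beta {Γ : Ctx} {σ τ : Ty} (t : Tm (σ :: Γ) τ) (u : Tm Γ σ) :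
      Step (.app (.lam t) u) (t.subst (TmSub.cons u TmSub.id))
  | beta_fst {Γ : Ctx} {σ τ : Ty} (t : Tm Γ σ) (u : Tm Γ τ) : Step (.fst (.pair t u)) t
  | beta_snd {Γ : Ctx} {σ τ : Ty} (t : Tm Γ σ) (u : Tm Γ τ) : Step (.snd (.pair t u)) u
  | iota_tt {Γ : Ctx} {σ : Ty} (u v : Tm Γ σ) : Step (.caseBool .tt u v) u
  | iota_ff {Γ : Ctx} {σ : Ty} (u v : Tm Γ σ) : Step (.caseBool .ff u v) v
  | iota_zero {Γ : Ctx} {σ : Ty} (u : Tm Γ σ) (v : Tm Γ (.arr .nat σ)) :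
      Step (.caseNat .zero u v) u
  | iota_succ {Γ : Ctx} {σ : Ty} (t : Tm Γ .nat) (u : Tm Γ σ) (v : Tm Γ (.arr .nat σ)) :
      Step (.caseNat (.succ t) u v) (.app v t)
  | iota_nil {Γ : Ctx} {τ σ : Ty} (u : Tm Γ σ) (v : Tm Γ (.arr τ (.arr (.list τ) σ))) :
      Step (.caseList .nil u v) u
  | iota_cons {Γ : Ctx} {τ σ : Ty} (h : Tm Γ τ) (t : Tm Γ (.list τ)) (u : Tm Γ σ)
      (v : Tm Γ (.arr τ (.arr (.list τ) σ))) :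
      Step (.caseList (.cons h t) u v) (.app (.app v h) t)
  | mu {Γ : Ctx} {ι σ : Ty} (hι : IsInd ι) (e : Tm (ι :: .arr ι σ :: Γ) σ) (c : Tm Γ ι) :
      c.IsCon → Step (.app (.letrec hι e) c)
        (e.subst (TmSub.cons c (TmSub.cons (.letrec hι e) TmSub.id)))
  | pair_l {Γ : Ctx} {σ τ : Ty} {t t' : Tm Γ σ} (u : Tm Γ τ) :
      Step t t' → Step (.pair t u) (.pair t' u)
  | pair_r {Γ : Ctx} {σ τ : Ty} (t : Tm Γ σ) {u u' : Tm Γ τ} :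
      Step u u' → Step (.pair t u) (.pair t u')
  | fst {Γ : Ctx} {σ τ : Ty} {t t' : Tm Γ (.prod σ τ)} : Step t t' → Step (.fst t) (.fst t')
  | snd {Γ : Ctx} {σ τ : Ty} {t t' : Tm Γ (.prod σ τ)} : Step t t' → Step (.snd t) (.snd t')
  | app_l {Γ : Ctx} {σ τ : Ty} {t t' : Tm Γ (.arr σ τ)} (u : Tm Γ σ) :
      Step t t' → Step (.app t u) (.app t' u)
  | app_r {Γ : Ctx} {σ τ : Ty} (t : Tm Γ (.arr σ τ)) {u u' : Tm Γ σ} :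
      Step u u' → Step (.app t u) (.app t u')
  | lam {Γ : Ctx} {σ τ : Ty} {t t' : Tm (σ :: Γ) τ} : Step t t' → Step (.lam t) (.lam t')
  | succ {Γ : Ctx} {t t' : Tm Γ .nat} : Step t t' → Step (.succ t) (.succ t')
  | cons_l {Γ : Ctx} {τ : Ty} {t t' : Tm Γ τ} (u : Tm Γ (.list τ)) :
      Step t t' → Step (.cons t u) (.cons t' u)
  | cons_r {Γ : Ctx} {τ : Ty} (t : Tm Γ τ) {u u' : Tm Γ (.list τ)} :
      Step u u' → Step (.cons t u) (.cons t u')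
  | caseBool_1 {Γ : Ctx} {σ : Ty} {t t' : Tm Γ .bool} (u v : Tm Γ σ) :
      Step t t' → Step (.caseBool t u v) (.caseBool t' u v)
  | caseBool_2 {Γ : Ctx} {σ : Ty} (t : Tm Γ .bool) {u u' : Tm Γ σ} (v : Tm Γ σ) :
      Step u u' → Step (.caseBool t u v) (.caseBool t u' v)
  | caseBool_3 {Γ : Ctx} {σ : Ty} (t : Tm Γ .bool) (u : Tm Γ σ) {v v' : Tm Γ σ} :
      Step v v' → Step (.caseBool t u v) (.caseBool t u v')
  | caseNat_1 {Γ : Ctx} {σ : Ty} {t t' : Tm Γ .nat} (u : Tm Γ σ) (v : Tm Γ (.arr .nat σ)) :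
      Step t t' → Step (.caseNat t u v) (.caseNat t' u v)
  | caseNat_2 {Γ : Ctx} {σ : Ty} (t : Tm Γ .nat) {u u' : Tm Γ σ} (v : Tm Γ (.arr .nat σ)) :
      Step u u' → Step (.caseNat t u v) (.caseNat t u' v)
  | caseNat_3 {Γ : Ctx} {σ : Ty} (t : Tm Γ .nat) (u : Tm Γ σ) {v v' : Tm Γ (.arr .nat σ)} :
      Step v v' → Step (.caseNat t u v) (.caseNat t u v')
  | caseList_1 {Γ : Ctx} {τ σ : Ty} {t t' : Tm Γ (.list τ)} (u : Tm Γ σ)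
      (v : Tm Γ (.arr τ (.arr (.list τ) σ))) :
      Step t t' → Step (.caseList t u v) (.caseList t' u v)
  | caseList_2 {Γ : Ctx} {τ σ : Ty} (t : Tm Γ (.list τ)) {u u' : Tm Γ σ}
      (v : Tm Γ (.arr τ (.arr (.list τ) σ))) :
      Step u u' → Step (.caseList t u v) (.caseList t u' v)
  | caseList_3 {Γ : Ctx} {τ σ : Ty} (t : Tm Γ (.list τ)) (u : Tm Γ σ)
      {v v' : Tm Γ (.arr τ (.arr (.list τ) σ))} :
      Step v v' → Step (.caseList t u v) (.caseList t u v')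
  | letrec {Γ : Ctx} {ι σ : Ty} (hι : IsInd ι) {e e' : Tm (ι :: .arr ι σ :: Γ) σ} :
      Step e e' → Step (.letrec hι e) (.letrec hι e')

/-- `βιμ`-conversion: the reflexive, symmetric and transitive closure of reduction. -/
def Conv {Γ : Ctx} {τ : Ty} : Tm Γ τ → Tm Γ τ → Prop := Relation.EqvGen Step

/-! ### Well-typed terms -/

/-- The terms `t` with `Γ ⊢ t : τ`: all recursive definitions in `t` satisfy `WellDef`. -/
def Term (Γ : Ctx) (τ : Ty) : Type := {t : Tm Γ τ // t.Legal}

/-- The interpretation of a well-typed term. -/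
noncomputable def Term.den {Γ : Ctx} {τ : Ty} (t : Term Γ τ) (ρ : Env Γ) : τ.Den := t.1.den ρ

/-- Simultaneous substitutions of well-typed terms for variables. -/
def Sub (Γ Δ : Ctx) : Type := ∀ τ, Var Γ τ → Term Δ τ

/-- Substitution in a well-typed term. -/
def Term.subst {Γ Δ : Ctx} {τ : Ty} (t : Term Γ τ) (θ : Sub Γ Δ) : Term Δ τ :=
  ⟨t.1.subst fun σ x => (θ σ x).1, Tm.Legal.subst _ _ (fun σ x => (θ σ x).2) t.2⟩

namespace Term

def var {Γ : Ctx} {τ : Ty} (x : Var Γ τ) : Term Γ τ := ⟨.var x, trivial⟩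

def pair {Γ : Ctx} {σ τ : Ty} (t : Term Γ σ) (u : Term Γ τ) : Term Γ (.prod σ τ) :=
  ⟨.pair t.1 u.1, t.2, u.2⟩

def fst {Γ : Ctx} {σ τ : Ty} (t : Term Γ (.prod σ τ)) : Term Γ σ := ⟨.fst t.1, t.2⟩

def snd {Γ : Ctx} {σ τ : Ty} (t : Term Γ (.prod σ τ)) : Term Γ τ := ⟨.snd t.1, t.2⟩

def app {Γ : Ctx} {σ τ : Ty} (t : Term Γ (.arr σ τ)) (u : Term Γ σ) : Term Γ τ :=
  ⟨.app t.1 u.1, t.2, u.2⟩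

def lam {Γ : Ctx} {σ τ : Ty} (t : Term (σ :: Γ) τ) : Term Γ (.arr σ τ) := ⟨.lam t.1, t.2⟩

def tt {Γ : Ctx} : Term Γ .bool := ⟨.tt, trivial⟩

def ff {Γ : Ctx} : Term Γ .bool := ⟨.ff, trivial⟩

def zero {Γ : Ctx} : Term Γ .nat := ⟨.zero, trivial⟩

def succ {Γ : Ctx} (t : Term Γ .nat) : Term Γ .nat := ⟨.succ t.1, t.2⟩

def nil {Γ : Ctx} {τ : Ty} : Term Γ (.list τ) := ⟨.nil, trivial⟩

def cons {Γ : Ctx} {τ : Ty} (t : Term Γ τ) (u : Term Γ (.list τ)) : Term Γ (.list τ) :=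
  ⟨.cons t.1 u.1, t.2, u.2⟩

def caseBool {Γ : Ctx} {σ : Ty} (t : Term Γ .bool) (u v : Term Γ σ) : Term Γ σ :=
  ⟨.caseBool t.1 u.1 v.1, t.2, u.2, v.2⟩

def caseNat {Γ : Ctx} {σ : Ty} (t : Term Γ .nat) (u : Term Γ σ) (v : Term Γ (.arr .nat σ)) :
    Term Γ σ :=
  ⟨.caseNat t.1 u.1 v.1, t.2, u.2, v.2⟩

def caseList {Γ : Ctx} {τ σ : Ty} (t : Term Γ (.list τ)) (u : Term Γ σ)
    (v : Term Γ (.arr τ (.arr (.list τ) σ))) : Term Γ σ :=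
  ⟨.caseList t.1 u.1 v.1, t.2, u.2, v.2⟩

/-- The typing rule for `letrec f x = e`: it requires `Def(f, x, e)`. -/
def letrec {Γ : Ctx} {ι σ : Ty} (hι : IsInd ι) (e : Term (ι :: .arr ι σ :: Γ) σ)
    (he : WellDef e.1) : Term Γ (.arr ι σ) :=
  ⟨.letrec hι e.1, he, e.2⟩

end Term

/-- `v0`, `v1`, … : the variables with de Bruijn index `0`, `1`, … -/
def v0 {Γ : Ctx} {a : Ty} : Term (a :: Γ) a := .var .z

def v1 {Γ : Ctx} {a b : Ty} : Term (a :: b :: Γ) b := .var (.s .z)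

def v2 {Γ : Ctx} {a b c : Ty} : Term (a :: b :: c :: Γ) c := .var (.s (.s .z))

def v3 {Γ : Ctx} {a b c d : Ty} : Term (a :: b :: c :: d :: Γ) d := .var (.s (.s (.s .z)))

def v4 {Γ : Ctx} {a b c d e : Ty} : Term (a :: b :: c :: d :: e :: Γ) e :=
  .var (.s (.s (.s (.s .z))))

def v5 {Γ : Ctx} {a b c d e f : Ty} : Term (a :: b :: c :: d :: e :: f :: Γ) f :=
  .var (.s (.s (.s (.s (.s .z)))))

/-- `w0` is the identity substitution, and `w1`, `w2`, … are the weakenings by `1`, `2`, …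
fresh variables. -/
def w0 {Γ : Ctx} : Sub Γ Γ := fun _ x => .var x

def w1 {Γ : Ctx} {a : Ty} : Sub Γ (a :: Γ) := fun _ x => .var (.s x)

def w2 {Γ : Ctx} {a b : Ty} : Sub Γ (a :: b :: Γ) := fun _ x => .var (.s (.s x))

def w3 {Γ : Ctx} {a b c : Ty} : Sub Γ (a :: b :: c :: Γ) := fun _ x => .var (.s (.s (.s x)))

def w4 {Γ : Ctx} {a b c d : Ty} : Sub Γ (a :: b :: c :: d :: Γ) :=
  fun _ x => .var (.s (.s (.s (.s x))))

def w5 {Γ : Ctx} {a b c d e : Ty} : Sub Γ (a :: b :: c :: d :: e :: Γ) :=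
  fun _ x => .var (.s (.s (.s (.s (.s x)))))

def w6 {Γ : Ctx} {a b c d e f : Ty} : Sub Γ (a :: b :: c :: d :: e :: f :: Γ) :=
  fun _ x => .var (.s (.s (.s (.s (.s (.s x))))))

/-- The substitution with no variables to replace. -/
def Sub.closed {Δ : Ctx} : Sub [] Δ := fun _ x => nomatch x

/-- The substitution that sends variable `0` to `t` and the other variables as `θ` does. -/
def Sub.cons {Γ Δ : Ctx} {σ : Ty} (t : Term Δ σ) (θ : Sub Γ Δ) : Sub (σ :: Γ) Δ := fun _ x =>
  match x with
  | .z => t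
  | .s y => θ _ y

/-- A substitution under a binder. -/
def Sub.lift {Γ Δ : Ctx} {σ : Ty} (θ : Sub Γ Δ) : Sub (σ :: Γ) (σ :: Δ) :=
  Sub.cons v0 fun _ x => (θ _ x).subst w1

infixr:67 " ▹ " => Sub.cons

/-! ### Assertions of higher-order logic -/

/-- Basic predicates, each with the list of the types of its arguments. -/
structure Signature where
  Pred : Type u
  arity : Pred → List Ty

/-- `Form S Γ`: the assertions `φ` with `Γ ⊢ φ`. The arguments of a basic predicate `P` are
given by a term for each position of its arity. Equality and the comparison of the sizes
of elements of an inductive type are built in. -/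
inductive Form (S : Signature.{u}) : Ctx → Type u
  | pred {Γ : Ctx} (P : S.Pred) (ts : Sub (S.arity P) Γ) : Form S Γ
  | eq {Γ : Ctx} {τ : Ty} (t t' : Term Γ τ) : Form S Γ
  | sizeLt {Γ : Ctx} {ι : Ty} (hι : IsInd ι) (t t' : Term Γ ι) : Form S Γ
  | sizeLe {Γ : Ctx} {ι : Ty} (hι : IsInd ι) (t t' : Term Γ ι) : Form S Γ
  | top {Γ : Ctx} : Form S Γ
  | bot {Γ : Ctx} : Form S Γ
  | and {Γ : Ctx} (φ ψ : Form S Γ) : Form S Γ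
  | or {Γ : Ctx} (φ ψ : Form S Γ) : Form S Γ
  | imp {Γ : Ctx} (φ ψ : Form S Γ) : Form S Γ
  | all {Γ : Ctx} (τ : Ty) (φ : Form S (τ :: Γ)) : Form S Γ
  | ex {Γ : Ctx} (τ : Ty) (φ : Form S (τ :: Γ)) : Form S Γ

infix:50 " ≐ " => Form.eq
infixr:35 " ⋏ " => Form.and
infixr:30 " ⋎ " => Form.or
infixr:25 " ⟹ " => Form.imp

/-- Capture-avoiding simultaneous substitution in an assertion. -/
def Form.subst {S : Signature.{u}} : {Γ Δ : Ctx} → Form S Γ → Sub Γ Δ → Form S Δ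
  | _, _, .pred P ts, θ => .pred P fun τ x => (ts τ x).subst θ
  | _, _, .eq t t', θ => .eq (t.subst θ) (t'.subst θ)
  | _, _, .sizeLt h t t', θ => .sizeLt h (t.subst θ) (t'.subst θ)
  | _, _, .sizeLe h t t', θ => .sizeLe h (t.subst θ) (t'.subst θ)
  | _, _, .top, _ => .top
  | _, _, .bot, _ => .bot
  | _, _, .and φ ψ, θ => .and (φ.subst θ) (ψ.subst θ)
  | _, _, .or φ ψ, θ => .or (φ.subst θ) (ψ.subst θ)
  | _, _, .imp φ ψ, θ => .imp (φ.subst θ) (ψ.subst θ)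
  | _, _, .all τ φ, θ => .all τ (φ.subst θ.lift)
  | _, _, .ex τ φ, θ => .ex τ (φ.subst θ.lift)

/-- An interpretation of the basic predicates: `⟦P⟧` is a set of tuples of elements of the
interpretations of the types of the arguments of `P`. -/
def Interp (S : Signature.{u}) : Type u := ∀ P : S.Pred, Set (Env (S.arity P))

/-- The interpretation `⟦φ⟧ρ` of an assertion. -/
def Form.Holds {S : Signature.{u}} (M : Interp S) : {Γ : Ctx} → Form S Γ → Env Γ → Prop
  | _, .pred P ts, ρ => (fun τ x => (ts τ x).den ρ) ∈ M P
  | _, .eq t t', ρ => t.den ρ = t'.den ρ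
  | _, @Form.sizeLt _ _ ι _ t t', ρ => ι.size (t.den ρ) < ι.size (t'.den ρ)
  | _, @Form.sizeLe _ _ ι _ t t', ρ => ι.size (t.den ρ) ≤ ι.size (t'.den ρ)
  | _, .top, _ => True
  | _, .bot, _ => False
  | _, .and φ ψ, ρ => φ.Holds M ρ ∧ ψ.Holds M ρ
  | _, .or φ ψ, ρ => φ.Holds M ρ ∨ ψ.Holds M ρ
  | _, .imp φ ψ, ρ => φ.Holds M ρ → ψ.Holds M ρ
  | _, .all τ φ, ρ => ∀ v : τ.Den, φ.Holds M (Env.cons v ρ)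
  | _, .ex τ φ, ρ => ∃ v : τ.Den, φ.Holds M (Env.cons v ρ)

/-- The interpretation `M` satisfies the axioms `Ax` of the basic predicates. -/
def Interp.Models {S : Signature.{u}} (M : Interp S) (Ax : Set (Form S [])) : Prop :=
  ∀ α ∈ Ax, α.Holds M Env.nil

namespace Form

/-- Logical equivalence. -/
def iff {S : Signature.{u}} {Γ : Ctx} (φ ψ : Form S Γ) : Form S Γ := (φ ⟹ ψ) ⋏ (ψ ⟹ φ)

/-- Disequality `t ≠ t'`. -/
def ne {S : Signature.{u}} {Γ : Ctx} {τ : Ty} (t t' : Term Γ τ) : Form S Γ := t ≐ t' ⟹ bot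

/-- `(|a|, |b|) < (|c|, |d|)`: both `|a| ≤ |c|` and `|b| ≤ |d|`, one of them strictly. -/
def sizeLt₂ {S : Signature.{u}} {Γ : Ctx} {ι₁ ι₂ : Ty} (h₁ : IsInd ι₁) (h₂ : IsInd ι₂)
    (a : Term Γ ι₁) (b : Term Γ ι₂) (c : Term Γ ι₁) (d : Term Γ ι₂) : Form S Γ :=
  sizeLe h₁ a c ⋏ sizeLe h₂ b d ⋏ (sizeLt h₁ a c ⋎ sizeLt h₂ b d)

end Form

/-- Weakening of a set of assertions. -/
def wk1 {S : Signature.{u}} {Γ : Ctx} {a : Ty} (Ψ : Set (Form S Γ)) : Set (Form S (a :: Γ)) :=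
  (fun ψ => ψ.subst w1) '' Ψ

def wk2 {S : Signature.{u}} {Γ : Ctx} {a b : Ty} (Ψ : Set (Form S Γ)) :
    Set (Form S (a :: b :: Γ)) :=
  (fun ψ => ψ.subst w2) '' Ψ

def wk4 {S : Signature.{u}} {Γ : Ctx} {a b c d : Ty} (Ψ : Set (Form S Γ)) :
    Set (Form S (a :: b :: c :: d :: Γ)) :=
  (fun ψ => ψ.subst w4) '' Ψ

/-! ### Higher-order logic -/

/-- `HOL Ax Ψ φ`: the judgment `Γ ∣ Ψ ⊢ φ` is derivable, where `Ax` are the (closed) axioms of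
the basic predicates. -/
inductive HOL {S : Signature.{u}} (Ax : Set (Form S [])) :
    {Γ : Ctx} → Set (Form S Γ) → Form S Γ → Prop
  | ax {Γ : Ctx} {Ψ : Set (Form S Γ)} {φ : Form S Γ} : φ ∈ Ψ → HOL Ax Ψ φ
  | predAx {Γ : Ctx} {Ψ : Set (Form S Γ)} {α : Form S []} :
      α ∈ Ax → HOL Ax Ψ (α.subst Sub.closed)
  | conv {Γ : Ctx} {Ψ : Set (Form S Γ)} {τ : Ty} (t t' : Term Γ τ) :
      Conv t.1 t'.1 → HOL Ax Ψ (t ≐ t')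
  | subst {Γ : Ctx} {Ψ : Set (Form S Γ)} {τ : Ty} (φ : Form S (τ :: Γ)) (t u : Term Γ τ) :
      HOL Ax Ψ (φ.subst (t ▹ w0)) → HOL Ax Ψ (t ≐ u) → HOL Ax Ψ (φ.subst (u ▹ w0))
  | imp_i {Γ : Ctx} {Ψ : Set (Form S Γ)} {φ ψ : Form S Γ} :
      HOL Ax (insert ψ Ψ) φ → HOL Ax Ψ (ψ ⟹ φ)
  | imp_e {Γ : Ctx} {Ψ : Set (Form S Γ)} {φ ψ : Form S Γ} :
      HOL Ax Ψ (ψ ⟹ φ) → HOL Ax Ψ ψ → HOL Ax Ψ φ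
  | all_i {Γ : Ctx} {Ψ : Set (Form S Γ)} {σ : Ty} {φ : Form S (σ :: Γ)} :
      HOL Ax (wk1 Ψ) φ → HOL Ax Ψ (.all σ φ)
  | all_e {Γ : Ctx} {Ψ : Set (Form S Γ)} {σ : Ty} {φ : Form S (σ :: Γ)} (t : Term Γ σ) :
      HOL Ax Ψ (.all σ φ) → HOL Ax Ψ (φ.subst (t ▹ w0))
  | ex_i {Γ : Ctx} {Ψ : Set (Form S Γ)} {σ : Ty} {φ : Form S (σ :: Γ)} (t : Term Γ σ) :
      HOL Ax Ψ (φ.subst (t ▹ w0)) → HOL Ax Ψ (.ex σ φ)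
  | ex_e {Γ : Ctx} {Ψ : Set (Form S Γ)} {σ : Ty} {φ : Form S (σ :: Γ)} {ψ : Form S Γ} :
      HOL Ax Ψ (.ex σ φ) → HOL Ax (insert φ (wk1 Ψ)) (ψ.subst w1) → HOL Ax Ψ ψ
  | top_i {Γ : Ctx} {Ψ : Set (Form S Γ)} : HOL Ax Ψ .top
  | bot_e {Γ : Ctx} {Ψ : Set (Form S Γ)} {φ : Form S Γ} : HOL Ax Ψ .bot → HOL Ax Ψ φ
  | and_i {Γ : Ctx} {Ψ : Set (Form S Γ)} {φ ψ : Form S Γ} :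
      HOL Ax Ψ φ → HOL Ax Ψ ψ → HOL Ax Ψ (φ ⋏ ψ)
  | and_e₁ {Γ : Ctx} {Ψ : Set (Form S Γ)} {φ ψ : Form S Γ} : HOL Ax Ψ (φ ⋏ ψ) → HOL Ax Ψ φ
  | and_e₂ {Γ : Ctx} {Ψ : Set (Form S Γ)} {φ ψ : Form S Γ} : HOL Ax Ψ (φ ⋏ ψ) → HOL Ax Ψ ψ
  | or_i₁ {Γ : Ctx} {Ψ : Set (Form S Γ)} {φ ψ : Form S Γ} : HOL Ax Ψ φ → HOL Ax Ψ (φ ⋎ ψ)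
  | or_i₂ {Γ : Ctx} {Ψ : Set (Form S Γ)} {φ ψ : Form S Γ} : HOL Ax Ψ ψ → HOL Ax Ψ (φ ⋎ ψ)
  | or_e {Γ : Ctx} {Ψ : Set (Form S Γ)} {φ ψ χ : Form S Γ} :
      HOL Ax Ψ (φ ⋎ ψ) → HOL Ax (insert φ Ψ) χ → HOL Ax (insert ψ Ψ) χ → HOL Ax Ψ χ
  | bool_ind {Γ : Ctx} {Ψ : Set (Form S Γ)} {φ : Form S (.bool :: Γ)} :
      HOL Ax Ψ (φ.subst (.tt ▹ w0)) → HOL Ax Ψ (φ.subst (.ff ▹ w0)) → HOL Ax Ψ (.all .bool φ)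
  | nat_ind {Γ : Ctx} {Ψ : Set (Form S Γ)} {φ : Form S (.nat :: Γ)} :
      HOL Ax Ψ (φ.subst (.zero ▹ w0)) →
      HOL Ax (insert φ (wk1 Ψ)) (φ.subst (.succ v0 ▹ w1)) →
      HOL Ax Ψ (.all .nat φ)
  | list_ind {Γ : Ctx} {Ψ : Set (Form S Γ)} {τ : Ty} {φ : Form S (.list τ :: Γ)} :
      HOL Ax Ψ (φ.subst (.nil ▹ w0)) →
      -- context `Γ, h : τ, t : list τ`, with `t` as `v0` and `h` as `v1`
      HOL Ax (insert (φ.subst (v0 ▹ w2)) (wk2 Ψ)) (φ.subst (.cons v1 v0 ▹ w2)) →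
      HOL Ax Ψ (.all (.list τ) φ)
  | strong_ind {Γ : Ctx} {Ψ : Set (Form S Γ)} {ι : Ty} (hι : IsInd ι) {φ : Form S (ι :: Γ)} :
      HOL Ax (insert (.all ι (.sizeLt hι v0 v1 ⟹ φ.subst (v0 ▹ w2))) (wk1 Ψ)) φ →
      HOL Ax Ψ (.all ι φ)
  | nc_bool {Γ : Ctx} {Ψ : Set (Form S Γ)} : HOL Ax Ψ (.ne .tt .ff)
  | nc_nat {Γ : Ctx} {Ψ : Set (Form S Γ)} (t : Term Γ .nat) : HOL Ax Ψ (.ne .zero (.succ t))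
  | nc_list {Γ : Ctx} {Ψ : Set (Form S Γ)} {τ : Ty} (h : Term Γ τ) (t : Term Γ (.list τ)) :
      HOL Ax Ψ (.ne .nil (.cons h t))
  | succ_inj {Γ : Ctx} {Ψ : Set (Form S Γ)} {t t' : Term Γ .nat} :
      HOL Ax Ψ (.succ t ≐ .succ t') → HOL Ax Ψ (t ≐ t')
  | cons_inj₁ {Γ : Ctx} {Ψ : Set (Form S Γ)} {τ : Ty} {h h' : Term Γ τ}
      {t t' : Term Γ (.list τ)} :
      HOL Ax Ψ (.cons h t ≐ .cons h' t') → HOL Ax Ψ (h ≐ h')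
  | cons_inj₂ {Γ : Ctx} {Ψ : Set (Form S Γ)} {τ : Ty} {h h' : Term Γ τ}
      {t t' : Term Γ (.list τ)} :
      HOL Ax Ψ (.cons h t ≐ .cons h' t') → HOL Ax Ψ (t ≐ t')

/-! ### Unary higher-order logic

In a judgment about `t : τ` in context `Γ`, the assertion lives in the context `Γ, r : τ`;
the distinguished variable `r` is variable `0`. -/

namespace Form

/-- `∀ x. φ' ⇒ φ[r x / r]`, where `φ'` lives in `Γ, x : τ` and `φ` in `Γ, x : τ, r : σ`. -/
def arrow {S : Signature.{u}} {Γ : Ctx} {τ σ : Ty} (φ' : Form S (τ :: Γ))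
    (φ : Form S (σ :: τ :: Γ)) : Form S (.arr τ σ :: Γ) :=
  all τ (φ'.subst (v0 ▹ w2) ⟹ φ.subst (.app v1 v0 ▹ v0 ▹ w2))

/-- `∀ x. t = S x ⇒ φ[r x / r]`. -/
def natBranch {S : Signature.{u}} {Γ : Ctx} {σ : Ty} (t : Term Γ .nat)
    (φ : Form S (σ :: Γ)) : Form S (.arr .nat σ :: Γ) :=
  all .nat (t.subst w2 ≐ .succ v0 ⟹ φ.subst (.app v1 v0 ▹ w2))

/-- `∀ h l. t = h :: l ⇒ φ[r h l / r]`. -/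
def listBranch {S : Signature.{u}} {Γ : Ctx} {τ σ : Ty} (t : Term Γ (.list τ))
    (φ : Form S (σ :: Γ)) : Form S (.arr τ (.arr (.list τ) σ) :: Γ) :=
  all τ (all (.list τ)
    (t.subst w3 ≐ .cons v1 v0 ⟹ φ.subst (.app (.app v2 v1) v0 ▹ w3)))

end Form

/-- `UHOL Ax Ψ t φ`: the judgment `Γ ∣ Ψ ⊢ t : τ ∣ φ` is derivable. -/
inductive UHOL {S : Signature.{u}} (Ax : Set (Form S [])) :
    {Γ : Ctx} → {τ : Ty} → Set (Form S Γ) → Term Γ τ → Form S (τ :: Γ) → Prop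
  | var {Γ : Ctx} {σ : Ty} {Ψ : Set (Form S Γ)} (x : Var Γ σ) {φ : Form S (σ :: Γ)} :
      HOL Ax Ψ (φ.subst (.var x ▹ w0)) → UHOL Ax Ψ (.var x) φ
  | abs {Γ : Ctx} {τ σ : Ty} {Ψ : Set (Form S Γ)} {t : Term (τ :: Γ) σ}
      {φ' : Form S (τ :: Γ)} {φ : Form S (σ :: τ :: Γ)} :
      UHOL Ax (insert φ' (wk1 Ψ)) t φ → UHOL Ax Ψ (.lam t) (.arrow φ' φ)
  | app {Γ : Ctx} {τ σ : Ty} {Ψ : Set (Form S Γ)} {t : Term Γ (.arr τ σ)} {u : Term Γ τ}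
      {φ' : Form S (τ :: Γ)} {φ : Form S (σ :: τ :: Γ)} :
      UHOL Ax Ψ t (.arrow φ' φ) → UHOL Ax Ψ u φ' →
      UHOL Ax Ψ (.app t u) (φ.subst (v0 ▹ u.subst w1 ▹ w1))
  | tt {Γ : Ctx} {Ψ : Set (Form S Γ)} {φ : Form S (.bool :: Γ)} :
      HOL Ax Ψ (φ.subst (.tt ▹ w0)) → UHOL Ax Ψ .tt φ
  | ff {Γ : Ctx} {Ψ : Set (Form S Γ)} {φ : Form S (.bool :: Γ)} :
      HOL Ax Ψ (φ.subst (.ff ▹ w0)) → UHOL Ax Ψ .ff φ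
  | zero {Γ : Ctx} {Ψ : Set (Form S Γ)} {φ : Form S (.nat :: Γ)} :
      HOL Ax Ψ (φ.subst (.zero ▹ w0)) → UHOL Ax Ψ .zero φ
  | succ {Γ : Ctx} {Ψ : Set (Form S Γ)} {t : Term Γ .nat} {φ' φ : Form S (.nat :: Γ)} :
      UHOL Ax Ψ t φ' →
      HOL Ax Ψ (.all .nat (φ'.subst (v0 ▹ w1) ⟹ φ.subst (.succ v0 ▹ w1))) →
      UHOL Ax Ψ (.succ t) φ
  | nil {Γ : Ctx} {σ : Ty} {Ψ : Set (Form S Γ)} {φ : Form S (.list σ :: Γ)} :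
      HOL Ax Ψ (φ.subst (.nil ▹ w0)) → UHOL Ax Ψ .nil φ
  | cons {Γ : Ctx} {σ : Ty} {Ψ : Set (Form S Γ)} {h : Term Γ σ} {t : Term Γ (.list σ)}
      {φ' : Form S (σ :: Γ)} {φ'' φ : Form S (.list σ :: Γ)} :
      UHOL Ax Ψ h φ' → UHOL Ax Ψ t φ'' →
      HOL Ax Ψ (.all σ (.all (.list σ)
        (φ'.subst (v1 ▹ w2) ⟹ φ''.subst (v0 ▹ w2) ⟹ φ.subst (.cons v1 v0 ▹ w2)))) →
      UHOL Ax Ψ (.cons h t) φ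
  | pair {Γ : Ctx} {σ τ : Ty} {Ψ : Set (Form S Γ)} {t : Term Γ σ} {u : Term Γ τ}
      {φ' : Form S (σ :: Γ)} {φ'' : Form S (τ :: Γ)} {φ : Form S (.prod σ τ :: Γ)} :
      UHOL Ax Ψ t φ' → UHOL Ax Ψ u φ'' →
      HOL Ax Ψ (.all σ (.all τ
        (φ'.subst (v1 ▹ w2) ⟹ φ''.subst (v0 ▹ w2) ⟹ φ.subst (.pair v1 v0 ▹ w2)))) →
      UHOL Ax Ψ (.pair t u) φ
  | proj₁ {Γ : Ctx} {σ τ : Ty} {Ψ : Set (Form S Γ)} {t : Term Γ (.prod σ τ)}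
      {φ : Form S (σ :: Γ)} :
      UHOL Ax Ψ t (φ.subst (.fst v0 ▹ w1)) → UHOL Ax Ψ (.fst t) φ
  | proj₂ {Γ : Ctx} {σ τ : Ty} {Ψ : Set (Form S Γ)} {t : Term Γ (.prod σ τ)}
      {φ : Form S (τ :: Γ)} :
      UHOL Ax Ψ t (φ.subst (.snd v0 ▹ w1)) → UHOL Ax Ψ (.snd t) φ
  | sub {Γ : Ctx} {σ : Ty} {Ψ : Set (Form S Γ)} {t : Term Γ σ} {φ' φ : Form S (σ :: Γ)} :
      UHOL Ax Ψ t φ' → HOL Ax Ψ (φ'.subst (t ▹ w0) ⟹ φ.subst (t ▹ w0)) → UHOL Ax Ψ t φ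
  | boolcase {Γ : Ctx} {σ : Ty} {Ψ : Set (Form S Γ)} {t : Term Γ .bool} {u v : Term Γ σ}
      {φ : Form S (σ :: Γ)} :
      UHOL Ax (insert (t ≐ .tt) Ψ) u φ → UHOL Ax (insert (t ≐ .ff) Ψ) v φ →
      UHOL Ax Ψ (.caseBool t u v) φ
  | natcase {Γ : Ctx} {σ : Ty} {Ψ : Set (Form S Γ)} {t : Term Γ .nat} {u : Term Γ σ}
      {v : Term Γ (.arr .nat σ)} {φ : Form S (σ :: Γ)} :
      UHOL Ax (insert (t ≐ .zero) Ψ) u φ → UHOL Ax Ψ v (.natBranch t φ) →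
      UHOL Ax Ψ (.caseNat t u v) φ
  | listcase {Γ : Ctx} {τ σ : Ty} {Ψ : Set (Form S Γ)} {t : Term Γ (.list τ)} {u : Term Γ σ}
      {v : Term Γ (.arr τ (.arr (.list τ) σ))} {φ : Form S (σ :: Γ)} :
      UHOL Ax (insert (t ≐ .nil) Ψ) u φ → UHOL Ax Ψ v (.listBranch t φ) →
      UHOL Ax Ψ (.caseList t u v) φ
  /- The premise lives in the context `Γ, f, x`, with `x` as `v0` and `f` as `v1`. -/
  | letrec {Γ : Ctx} {ι σ : Ty} {Ψ : Set (Form S Γ)} (hι : IsInd ι)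
      {e : Term (ι :: .arr ι σ :: Γ) σ} (he : WellDef e.1)
      {φ' : Form S (ι :: Γ)} {φ : Form S (σ :: ι :: Γ)} :
      UHOL Ax
        (insert (.all ι (.sizeLt hι v0 v1 ⟹ φ'.subst (v0 ▹ w3) ⟹
            φ.subst (.app v2 v0 ▹ v0 ▹ w3)))
          (insert (φ'.subst (v0 ▹ w2)) (wk2 Ψ)))
        e (φ.subst (v0 ▹ v1 ▹ w3)) →
      UHOL Ax Ψ (.letrec hι e he) (.arrow φ' φ)

/-! ### Relational higher-order logic

In a judgment about `t₁ : σ₁` and `t₂ : σ₂` in context `Γ`, the assertion lives in the context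
`Γ, r₂ : σ₂, r₁ : σ₁`; the distinguished variable `r₁` is variable `0` and `r₂` is
variable `1`. -/

namespace Form

variable {S : Signature.{u}} {Γ : Ctx}

/-- `∀ x₁ x₂. φ' ⇒ φ[r₁ x₁ / r₁][r₂ x₂ / r₂]`. -/
def arrow₂ {τ₁ τ₂ σ₁ σ₂ : Ty} (φ' : Form S (τ₁ :: τ₂ :: Γ))
    (φ : Form S (σ₁ :: σ₂ :: τ₁ :: τ₂ :: Γ)) : Form S (.arr τ₁ σ₁ :: .arr τ₂ σ₂ :: Γ) :=
  all τ₁ (all τ₂ (φ'.subst (v1 ▹ v0 ▹ w4) ⟹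
    φ.subst (.app v2 v1 ▹ .app v3 v0 ▹ v1 ▹ v0 ▹ w4)))

/-- `∀ x₁. φ' ⇒ φ[r₁ x₁ / r₁]`. -/
def arrowL {τ₁ σ₁ σ₂ : Ty} (φ' : Form S (τ₁ :: Γ)) (φ : Form S (σ₁ :: σ₂ :: τ₁ :: Γ)) :
    Form S (.arr τ₁ σ₁ :: σ₂ :: Γ) :=
  all τ₁ (φ'.subst (v0 ▹ w3) ⟹ φ.subst (.app v1 v0 ▹ v2 ▹ v0 ▹ w3))

/-- `∀ x₂. φ' ⇒ φ[r₂ x₂ / r₂]`. -/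
def arrowR {τ₂ σ₁ σ₂ : Ty} (φ' : Form S (τ₂ :: Γ)) (φ : Form S (σ₁ :: σ₂ :: τ₂ :: Γ)) :
    Form S (σ₁ :: .arr τ₂ σ₂ :: Γ) :=
  all τ₂ (φ'.subst (v0 ▹ w3) ⟹ φ.subst (v1 ▹ .app v2 v0 ▹ v0 ▹ w3))

/-- `∀ x₁. t₁ = S x₁ ⇒ φ[r₁ x₁ / r₁]`. -/
def natBranchL {σ₁ σ₂ : Ty} (t₁ : Term Γ .nat) (φ : Form S (σ₁ :: σ₂ :: Γ)) :
    Form S (.arr .nat σ₁ :: σ₂ :: Γ) :=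
  all .nat (t₁.subst w3 ≐ .succ v0 ⟹ φ.subst (.app v1 v0 ▹ v2 ▹ w3))

/-- `∀ x₂. t₂ = S x₂ ⇒ φ[r₂ x₂ / r₂]`. -/
def natBranchR {σ₁ σ₂ : Ty} (t₂ : Term Γ .nat) (φ : Form S (σ₁ :: σ₂ :: Γ)) :
    Form S (σ₁ :: .arr .nat σ₂ :: Γ) :=
  all .nat (t₂.subst w3 ≐ .succ v0 ⟹ φ.subst (v1 ▹ .app v2 v0 ▹ w3))

/-- `∀ h₁ l₁. t₁ = h₁ :: l₁ ⇒ φ[r₁ h₁ l₁ / r₁]`. -/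
def listBranchL {τ₁ σ₁ σ₂ : Ty} (t₁ : Term Γ (.list τ₁)) (φ : Form S (σ₁ :: σ₂ :: Γ)) :
    Form S (.arr τ₁ (.arr (.list τ₁) σ₁) :: σ₂ :: Γ) :=
  all τ₁ (all (.list τ₁)
    (t₁.subst w4 ≐ .cons v1 v0 ⟹ φ.subst (.app (.app v2 v1) v0 ▹ v3 ▹ w4)))

/-- `∀ h₂ l₂. t₂ = h₂ :: l₂ ⇒ φ[r₂ h₂ l₂ / r₂]`. -/
def listBranchR {τ₂ σ₁ σ₂ : Ty} (t₂ : Term Γ (.list τ₂)) (φ : Form S (σ₁ :: σ₂ :: Γ)) :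
    Form S (σ₁ :: .arr τ₂ (.arr (.list τ₂) σ₂) :: Γ) :=
  all τ₂ (all (.list τ₂)
    (t₂.subst w4 ≐ .cons v1 v0 ⟹ φ.subst (v2 ▹ .app (.app v3 v1) v0 ▹ w4)))

/-- `∀ x₁ x₂. t₁ = S x₁ ⇒ t₂ = S x₂ ⇒ φ[r₁ x₁ / r₁][r₂ x₂ / r₂]`. -/
def natNatBranch {σ₁ σ₂ : Ty} (t₁ t₂ : Term Γ .nat) (φ : Form S (σ₁ :: σ₂ :: Γ)) :
    Form S (.arr .nat σ₁ :: .arr .nat σ₂ :: Γ) :=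
  all .nat (all .nat
    (t₁.subst w4 ≐ .succ v1 ⟹ t₂.subst w4 ≐ .succ v0 ⟹
      φ.subst (.app v2 v1 ▹ .app v3 v0 ▹ w4)))

/-- `∀ x₁ h₂ l₂. t₁ = S x₁ ⇒ t₂ = h₂ :: l₂ ⇒ φ[r₁ x₁ / r₁][r₂ h₂ l₂ / r₂]`. -/
def natListBranch {τ₂ σ₁ σ₂ : Ty} (t₁ : Term Γ .nat) (t₂ : Term Γ (.list τ₂))
    (φ : Form S (σ₁ :: σ₂ :: Γ)) :
    Form S (.arr .nat σ₁ :: .arr τ₂ (.arr (.list τ₂) σ₂) :: Γ) :=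
  all .nat (all τ₂ (all (.list τ₂)
    (t₁.subst w5 ≐ .succ v2 ⟹ t₂.subst w5 ≐ .cons v1 v0 ⟹
      φ.subst (.app v3 v2 ▹ .app (.app v4 v1) v0 ▹ w5))))

/-- `∀ h₁ l₁ x₂. t₁ = h₁ :: l₁ ⇒ t₂ = S x₂ ⇒ φ[r₁ h₁ l₁ / r₁][r₂ x₂ / r₂]`. -/
def listNatBranch {τ₁ σ₁ σ₂ : Ty} (t₁ : Term Γ (.list τ₁)) (t₂ : Term Γ .nat)
    (φ : Form S (σ₁ :: σ₂ :: Γ)) :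
    Form S (.arr τ₁ (.arr (.list τ₁) σ₁) :: .arr .nat σ₂ :: Γ) :=
  all τ₁ (all (.list τ₁) (all .nat
    (t₁.subst w5 ≐ .cons v2 v1 ⟹ t₂.subst w5 ≐ .succ v0 ⟹
      φ.subst (.app (.app v3 v2) v1 ▹ .app v4 v0 ▹ w5))))

/-- `∀ h₁ h₂ l₁ l₂. t₁ = h₁ :: l₁ ⇒ t₂ = h₂ :: l₂ ⇒ φ[r₁ h₁ l₁ / r₁][r₂ h₂ l₂ / r₂]`. -/
def listListBranch {τ₁ τ₂ σ₁ σ₂ : Ty} (t₁ : Term Γ (.list τ₁)) (t₂ : Term Γ (.list τ₂))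
    (φ : Form S (σ₁ :: σ₂ :: Γ)) :
    Form S (.arr τ₁ (.arr (.list τ₁) σ₁) :: .arr τ₂ (.arr (.list τ₂) σ₂) :: Γ) :=
  all τ₁ (all τ₂ (all (.list τ₁) (all (.list τ₂)
    (t₁.subst w6 ≐ .cons v3 v1 ⟹ t₂.subst w6 ≐ .cons v2 v0 ⟹
      φ.subst (.app (.app v4 v3) v1 ▹ .app (.app v5 v2) v0 ▹ w6)))))

end Form

/-- `RHOL Ax Ψ t₁ t₂ φ`: the judgment `Γ ∣ Ψ ⊢ t₁ : σ₁ ∼ t₂ : σ₂ ∣ φ` is derivable. -/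
inductive RHOL {S : Signature.{u}} (Ax : Set (Form S [])) :
    {Γ : Ctx} → {σ₁ σ₂ : Ty} → Set (Form S Γ) → Term Γ σ₁ → Term Γ σ₂ →
      Form S (σ₁ :: σ₂ :: Γ) → Prop
  /- Two-sided rules. -/
  | abs {Γ : Ctx} {τ₁ τ₂ σ₁ σ₂ : Ty} {Ψ : Set (Form S Γ)}
      {t₁ : Term (τ₁ :: Γ) σ₁} {t₂ : Term (τ₂ :: Γ) σ₂}
      {φ' : Form S (τ₁ :: τ₂ :: Γ)} {φ : Form S (σ₁ :: σ₂ :: τ₁ :: τ₂ :: Γ)} :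
      RHOL Ax (insert φ' (wk2 Ψ)) (t₁.subst (v0 ▹ w2)) (t₂.subst (v1 ▹ w2)) φ →
      RHOL Ax Ψ (.lam t₁) (.lam t₂) (.arrow₂ φ' φ)
  | app {Γ : Ctx} {τ₁ τ₂ σ₁ σ₂ : Ty} {Ψ : Set (Form S Γ)}
      {t₁ : Term Γ (.arr τ₁ σ₁)} {t₂ : Term Γ (.arr τ₂ σ₂)} {u₁ : Term Γ τ₁} {u₂ : Term Γ τ₂}
      {φ' : Form S (τ₁ :: τ₂ :: Γ)} {φ : Form S (σ₁ :: σ₂ :: τ₁ :: τ₂ :: Γ)} :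
      RHOL Ax Ψ t₁ t₂ (.arrow₂ φ' φ) → RHOL Ax Ψ u₁ u₂ φ' →
      RHOL Ax Ψ (.app t₁ u₁) (.app t₂ u₂)
        (φ.subst (v0 ▹ v1 ▹ u₁.subst w2 ▹ u₂.subst w2 ▹ w2))
  | var {Γ : Ctx} {σ₁ σ₂ : Ty} {Ψ : Set (Form S Γ)} (x₁ : Var Γ σ₁) (x₂ : Var Γ σ₂)
      {φ : Form S (σ₁ :: σ₂ :: Γ)} :
      HOL Ax Ψ (φ.subst (.var x₁ ▹ .var x₂ ▹ w0)) → RHOL Ax Ψ (.var x₁) (.var x₂) φ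
  | tt {Γ : Ctx} {Ψ : Set (Form S Γ)} {φ : Form S (.bool :: .bool :: Γ)} :
      HOL Ax Ψ (φ.subst (.tt ▹ .tt ▹ w0)) → RHOL Ax Ψ .tt .tt φ
  | ff {Γ : Ctx} {Ψ : Set (Form S Γ)} {φ : Form S (.bool :: .bool :: Γ)} :
      HOL Ax Ψ (φ.subst (.ff ▹ .ff ▹ w0)) → RHOL Ax Ψ .ff .ff φ
  | zero {Γ : Ctx} {Ψ : Set (Form S Γ)} {φ : Form S (.nat :: .nat :: Γ)} :
      HOL Ax Ψ (φ.subst (.zero ▹ .zero ▹ w0)) → RHOL Ax Ψ .zero .zero φ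
  | succ {Γ : Ctx} {Ψ : Set (Form S Γ)} {t₁ t₂ : Term Γ .nat}
      {φ' φ : Form S (.nat :: .nat :: Γ)} :
      RHOL Ax Ψ t₁ t₂ φ' →
      HOL Ax Ψ (.all .nat (.all .nat
        (φ'.subst (v1 ▹ v0 ▹ w2) ⟹ φ.subst (.succ v1 ▹ .succ v0 ▹ w2)))) →
      RHOL Ax Ψ (.succ t₁) (.succ t₂) φ
  | nil {Γ : Ctx} {σ₁ σ₂ : Ty} {Ψ : Set (Form S Γ)}
      {φ : Form S (.list σ₁ :: .list σ₂ :: Γ)} :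
      HOL Ax Ψ (φ.subst (.nil ▹ .nil ▹ w0)) → RHOL Ax Ψ .nil .nil φ
  | cons {Γ : Ctx} {σ₁ σ₂ : Ty} {Ψ : Set (Form S Γ)} {h₁ : Term Γ σ₁} {h₂ : Term Γ σ₂}
      {t₁ : Term Γ (.list σ₁)} {t₂ : Term Γ (.list σ₂)}
      {φ' : Form S (σ₁ :: σ₂ :: Γ)} {φ'' φ : Form S (.list σ₁ :: .list σ₂ :: Γ)} :
      RHOL Ax Ψ h₁ h₂ φ' → RHOL Ax Ψ t₁ t₂ φ'' →
      HOL Ax Ψ (.all σ₁ (.all σ₂ (.all (.list σ₁) (.all (.list σ₂)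
        (φ'.subst (v3 ▹ v2 ▹ w4) ⟹ φ''.subst (v1 ▹ v0 ▹ w4) ⟹
          φ.subst (.cons v3 v1 ▹ .cons v2 v0 ▹ w4)))))) →
      RHOL Ax Ψ (.cons h₁ t₁) (.cons h₂ t₂) φ
  | pair {Γ : Ctx} {σ₁ σ₂ τ₁ τ₂ : Ty} {Ψ : Set (Form S Γ)} {t₁ : Term Γ σ₁} {t₂ : Term Γ σ₂}
      {u₁ : Term Γ τ₁} {u₂ : Term Γ τ₂}
      {φ' : Form S (σ₁ :: σ₂ :: Γ)} {φ'' : Form S (τ₁ :: τ₂ :: Γ)}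
      {φ : Form S (.prod σ₁ τ₁ :: .prod σ₂ τ₂ :: Γ)} :
      RHOL Ax Ψ t₁ t₂ φ' → RHOL Ax Ψ u₁ u₂ φ'' →
      HOL Ax Ψ (.all σ₁ (.all σ₂ (.all τ₁ (.all τ₂
        (φ'.subst (v3 ▹ v2 ▹ w4) ⟹ φ''.subst (v1 ▹ v0 ▹ w4) ⟹
          φ.subst (.pair v3 v1 ▹ .pair v2 v0 ▹ w4)))))) →
      RHOL Ax Ψ (.pair t₁ u₁) (.pair t₂ u₂) φ
  | proj₁ {Γ : Ctx} {σ₁ σ₂ τ₁ τ₂ : Ty} {Ψ : Set (Form S Γ)} {t₁ : Term Γ (.prod σ₁ τ₁)}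
      {t₂ : Term Γ (.prod σ₂ τ₂)} {φ : Form S (σ₁ :: σ₂ :: Γ)} :
      RHOL Ax Ψ t₁ t₂ (φ.subst (.fst v0 ▹ .fst v1 ▹ w2)) → RHOL Ax Ψ (.fst t₁) (.fst t₂) φ
  | proj₂ {Γ : Ctx} {σ₁ σ₂ τ₁ τ₂ : Ty} {Ψ : Set (Form S Γ)} {t₁ : Term Γ (.prod σ₁ τ₁)}
      {t₂ : Term Γ (.prod σ₂ τ₂)} {φ : Form S (τ₁ :: τ₂ :: Γ)} :
      RHOL Ax Ψ t₁ t₂ (φ.subst (.snd v0 ▹ .snd v1 ▹ w2)) → RHOL Ax Ψ (.snd t₁) (.snd t₂) φ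
  /- Structural rules. -/
  | sub {Γ : Ctx} {σ₁ σ₂ : Ty} {Ψ : Set (Form S Γ)} {t₁ : Term Γ σ₁} {t₂ : Term Γ σ₂}
      {φ' φ : Form S (σ₁ :: σ₂ :: Γ)} :
      RHOL Ax Ψ t₁ t₂ φ' →
      HOL Ax Ψ (φ'.subst (t₁ ▹ t₂ ▹ w0) ⟹ φ.subst (t₁ ▹ t₂ ▹ w0)) → RHOL Ax Ψ t₁ t₂ φ
  | and_i {Γ : Ctx} {σ₁ σ₂ : Ty} {Ψ : Set (Form S Γ)} {t₁ : Term Γ σ₁} {t₂ : Term Γ σ₂}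
      {φ φ' : Form S (σ₁ :: σ₂ :: Γ)} :
      RHOL Ax Ψ t₁ t₂ φ → RHOL Ax Ψ t₁ t₂ φ' → RHOL Ax Ψ t₁ t₂ (φ ⋏ φ')
  | imp_i {Γ : Ctx} {σ₁ σ₂ : Ty} {Ψ : Set (Form S Γ)} {t₁ : Term Γ σ₁} {t₂ : Term Γ σ₂}
      {φ φ' : Form S (σ₁ :: σ₂ :: Γ)} :
      RHOL Ax (insert (φ'.subst (t₁ ▹ t₂ ▹ w0)) Ψ) t₁ t₂ φ → RHOL Ax Ψ t₁ t₂ (φ' ⟹ φ)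
  | uholL {Γ : Ctx} {σ₁ σ₂ : Ty} {Ψ : Set (Form S Γ)} {t₁ : Term Γ σ₁} {t₂ : Term Γ σ₂}
      {φ : Form S (σ₁ :: σ₂ :: Γ)} :
      UHOL Ax Ψ t₁ (φ.subst (v0 ▹ t₂.subst w1 ▹ w1)) → RHOL Ax Ψ t₁ t₂ φ
  | uholR {Γ : Ctx} {σ₁ σ₂ : Ty} {Ψ : Set (Form S Γ)} {t₁ : Term Γ σ₁} {t₂ : Term Γ σ₂}
      {φ : Form S (σ₁ :: σ₂ :: Γ)} :
      UHOL Ax Ψ t₂ (φ.subst (t₁.subst w1 ▹ v0 ▹ w1)) → RHOL Ax Ψ t₁ t₂ φ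
  /- One-sided rules, left. -/
  | absL {Γ : Ctx} {τ₁ σ₁ σ₂ : Ty} {Ψ : Set (Form S Γ)} {t₁ : Term (τ₁ :: Γ) σ₁}
      {t₂ : Term Γ σ₂} {φ' : Form S (τ₁ :: Γ)} {φ : Form S (σ₁ :: σ₂ :: τ₁ :: Γ)} :
      RHOL Ax (insert φ' (wk1 Ψ)) t₁ (t₂.subst w1) φ → RHOL Ax Ψ (.lam t₁) t₂ (.arrowL φ' φ)
  | appL {Γ : Ctx} {τ₁ σ₁ σ₂ : Ty} {Ψ : Set (Form S Γ)} {t₁ : Term Γ (.arr τ₁ σ₁)}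
      {u₁ : Term Γ τ₁} {t₂ : Term Γ σ₂} {φ' : Form S (τ₁ :: Γ)}
      {φ : Form S (σ₁ :: σ₂ :: τ₁ :: Γ)} :
      RHOL Ax Ψ t₁ t₂ (.arrowL φ' φ) → UHOL Ax Ψ u₁ φ' →
      RHOL Ax Ψ (.app t₁ u₁) t₂ (φ.subst (v0 ▹ v1 ▹ u₁.subst w2 ▹ w2))
  /- An assertion in which `r₂` is not free is the weakening of an assertion `φ` in
  the context `Γ, r₁`. -/
  | varL {Γ : Ctx} {σ₁ σ₂ : Ty} {Ψ : Set (Form S Γ)} (x₁ : Var Γ σ₁) (t₂ : Term Γ σ₂)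
      {φ : Form S (σ₁ :: Γ)} :
      φ.subst (.var x₁ ▹ w0) ∈ Ψ → RHOL Ax Ψ (.var x₁) t₂ (φ.subst (v0 ▹ w2))
  | ttL {Γ : Ctx} {σ₂ : Ty} {Ψ : Set (Form S Γ)} {t₂ : Term Γ σ₂}
      {φ : Form S (.bool :: σ₂ :: Γ)} :
      HOL Ax Ψ (φ.subst (.tt ▹ t₂ ▹ w0)) → RHOL Ax Ψ .tt t₂ φ
  | ffL {Γ : Ctx} {σ₂ : Ty} {Ψ : Set (Form S Γ)} {t₂ : Term Γ σ₂}
      {φ : Form S (.bool :: σ₂ :: Γ)} :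
      HOL Ax Ψ (φ.subst (.ff ▹ t₂ ▹ w0)) → RHOL Ax Ψ .ff t₂ φ
  | zeroL {Γ : Ctx} {σ₂ : Ty} {Ψ : Set (Form S Γ)} {t₂ : Term Γ σ₂}
      {φ : Form S (.nat :: σ₂ :: Γ)} :
      HOL Ax Ψ (φ.subst (.zero ▹ t₂ ▹ w0)) → RHOL Ax Ψ .zero t₂ φ
  | succL {Γ : Ctx} {σ₂ : Ty} {Ψ : Set (Form S Γ)} {t₁ : Term Γ .nat} {t₂ : Term Γ σ₂}
      {φ' φ : Form S (.nat :: σ₂ :: Γ)} :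
      RHOL Ax Ψ t₁ t₂ φ' →
      HOL Ax Ψ (.all .nat (.all σ₂
        (φ'.subst (v1 ▹ v0 ▹ w2) ⟹ φ.subst (.succ v1 ▹ v0 ▹ w2)))) →
      RHOL Ax Ψ (.succ t₁) t₂ φ
  | nilL {Γ : Ctx} {σ₁ σ₂ : Ty} {Ψ : Set (Form S Γ)} {t₂ : Term Γ σ₂}
      {φ : Form S (.list σ₁ :: σ₂ :: Γ)} :
      HOL Ax Ψ (φ.subst (.nil ▹ t₂ ▹ w0)) → RHOL Ax Ψ .nil t₂ φ
  | consL {Γ : Ctx} {σ₁ σ₂ : Ty} {Ψ : Set (Form S Γ)} {h₁ : Term Γ σ₁}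
      {t₁ : Term Γ (.list σ₁)} {t₂ : Term Γ σ₂}
      {φ' : Form S (σ₁ :: σ₂ :: Γ)} {φ'' φ : Form S (.list σ₁ :: σ₂ :: Γ)} :
      RHOL Ax Ψ h₁ t₂ φ' → RHOL Ax Ψ t₁ t₂ φ'' →
      HOL Ax Ψ (.all σ₁ (.all σ₂ (.all (.list σ₁)
        (φ'.subst (v2 ▹ v1 ▹ w3) ⟹ φ''.subst (v0 ▹ v1 ▹ w3) ⟹
          φ.subst (.cons v2 v0 ▹ v1 ▹ w3))))) →
      RHOL Ax Ψ (.cons h₁ t₁) t₂ φ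
  | pairL {Γ : Ctx} {σ₁ τ₁ σ₂ : Ty} {Ψ : Set (Form S Γ)} {t₁ : Term Γ σ₁} {u₁ : Term Γ τ₁}
      {t₂ : Term Γ σ₂} {φ' : Form S (σ₁ :: σ₂ :: Γ)} {φ'' : Form S (τ₁ :: σ₂ :: Γ)}
      {φ : Form S (.prod σ₁ τ₁ :: σ₂ :: Γ)} :
      RHOL Ax Ψ t₁ t₂ φ' → RHOL Ax Ψ u₁ t₂ φ'' →
      HOL Ax Ψ (.all σ₁ (.all σ₂ (.all τ₁
        (φ'.subst (v2 ▹ v1 ▹ w3) ⟹ φ''.subst (v0 ▹ v1 ▹ w3) ⟹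
          φ.subst (.pair v2 v0 ▹ v1 ▹ w3))))) →
      RHOL Ax Ψ (.pair t₁ u₁) t₂ φ
  | proj₁L {Γ : Ctx} {σ₁ τ₁ σ₂ : Ty} {Ψ : Set (Form S Γ)} {t₁ : Term Γ (.prod σ₁ τ₁)}
      {t₂ : Term Γ σ₂} {φ : Form S (σ₁ :: σ₂ :: Γ)} :
      RHOL Ax Ψ t₁ t₂ (φ.subst (.fst v0 ▹ v1 ▹ w2)) → RHOL Ax Ψ (.fst t₁) t₂ φ
  | proj₂L {Γ : Ctx} {σ₁ τ₁ σ₂ : Ty} {Ψ : Set (Form S Γ)} {t₁ : Term Γ (.prod σ₁ τ₁)}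
      {t₂ : Term Γ σ₂} {φ : Form S (τ₁ :: σ₂ :: Γ)} :
      RHOL Ax Ψ t₁ t₂ (φ.subst (.snd v0 ▹ v1 ▹ w2)) → RHOL Ax Ψ (.snd t₁) t₂ φ
  /- One-sided rules, right. -/
  | absR {Γ : Ctx} {τ₂ σ₁ σ₂ : Ty} {Ψ : Set (Form S Γ)} {t₁ : Term Γ σ₁}
      {t₂ : Term (τ₂ :: Γ) σ₂} {φ' : Form S (τ₂ :: Γ)} {φ : Form S (σ₁ :: σ₂ :: τ₂ :: Γ)} :
      RHOL Ax (insert φ' (wk1 Ψ)) (t₁.subst w1) t₂ φ → RHOL Ax Ψ t₁ (.lam t₂) (.arrowR φ' φ)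
  | appR {Γ : Ctx} {τ₂ σ₁ σ₂ : Ty} {Ψ : Set (Form S Γ)} {t₁ : Term Γ σ₁}
      {t₂ : Term Γ (.arr τ₂ σ₂)} {u₂ : Term Γ τ₂} {φ' : Form S (τ₂ :: Γ)}
      {φ : Form S (σ₁ :: σ₂ :: τ₂ :: Γ)} :
      RHOL Ax Ψ t₁ t₂ (.arrowR φ' φ) → UHOL Ax Ψ u₂ φ' →
      RHOL Ax Ψ t₁ (.app t₂ u₂) (φ.subst (v0 ▹ v1 ▹ u₂.subst w2 ▹ w2))
  | varR {Γ : Ctx} {σ₁ σ₂ : Ty} {Ψ : Set (Form S Γ)} (t₁ : Term Γ σ₁) (x₂ : Var Γ σ₂)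
      {φ : Form S (σ₂ :: Γ)} :
      φ.subst (.var x₂ ▹ w0) ∈ Ψ → RHOL Ax Ψ t₁ (.var x₂) (φ.subst (v1 ▹ w2))
  | ttR {Γ : Ctx} {σ₁ : Ty} {Ψ : Set (Form S Γ)} {t₁ : Term Γ σ₁}
      {φ : Form S (σ₁ :: .bool :: Γ)} :
      HOL Ax Ψ (φ.subst (t₁ ▹ .tt ▹ w0)) → RHOL Ax Ψ t₁ .tt φ
  | ffR {Γ : Ctx} {σ₁ : Ty} {Ψ : Set (Form S Γ)} {t₁ : Term Γ σ₁}
      {φ : Form S (σ₁ :: .bool :: Γ)} :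
      HOL Ax Ψ (φ.subst (t₁ ▹ .ff ▹ w0)) → RHOL Ax Ψ t₁ .ff φ
  | zeroR {Γ : Ctx} {σ₁ : Ty} {Ψ : Set (Form S Γ)} {t₁ : Term Γ σ₁}
      {φ : Form S (σ₁ :: .nat :: Γ)} :
      HOL Ax Ψ (φ.subst (t₁ ▹ .zero ▹ w0)) → RHOL Ax Ψ t₁ .zero φ
  | succR {Γ : Ctx} {σ₁ : Ty} {Ψ : Set (Form S Γ)} {t₁ : Term Γ σ₁} {t₂ : Term Γ .nat}
      {φ' φ : Form S (σ₁ :: .nat :: Γ)} :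
      RHOL Ax Ψ t₁ t₂ φ' →
      HOL Ax Ψ (.all σ₁ (.all .nat
        (φ'.subst (v1 ▹ v0 ▹ w2) ⟹ φ.subst (v1 ▹ .succ v0 ▹ w2)))) →
      RHOL Ax Ψ t₁ (.succ t₂) φ
  | nilR {Γ : Ctx} {σ₁ σ₂ : Ty} {Ψ : Set (Form S Γ)} {t₁ : Term Γ σ₁}
      {φ : Form S (σ₁ :: .list σ₂ :: Γ)} :
      HOL Ax Ψ (φ.subst (t₁ ▹ .nil ▹ w0)) → RHOL Ax Ψ t₁ .nil φ
  | consR {Γ : Ctx} {σ₁ σ₂ : Ty} {Ψ : Set (Form S Γ)} {t₁ : Term Γ σ₁} {h₂ : Term Γ σ₂}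
      {t₂ : Term Γ (.list σ₂)}
      {φ' : Form S (σ₁ :: σ₂ :: Γ)} {φ'' φ : Form S (σ₁ :: .list σ₂ :: Γ)} :
      RHOL Ax Ψ t₁ h₂ φ' → RHOL Ax Ψ t₁ t₂ φ'' →
      HOL Ax Ψ (.all σ₁ (.all σ₂ (.all (.list σ₂)
        (φ'.subst (v2 ▹ v1 ▹ w3) ⟹ φ''.subst (v2 ▹ v0 ▹ w3) ⟹
          φ.subst (v2 ▹ .cons v1 v0 ▹ w3))))) →
      RHOL Ax Ψ t₁ (.cons h₂ t₂) φ
  | pairR {Γ : Ctx} {σ₁ σ₂ τ₂ : Ty} {Ψ : Set (Form S Γ)} {t₁ : Term Γ σ₁} {t₂ : Term Γ σ₂}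
      {u₂ : Term Γ τ₂} {φ' : Form S (σ₁ :: σ₂ :: Γ)} {φ'' : Form S (σ₁ :: τ₂ :: Γ)}
      {φ : Form S (σ₁ :: .prod σ₂ τ₂ :: Γ)} :
      RHOL Ax Ψ t₁ t₂ φ' → RHOL Ax Ψ t₁ u₂ φ'' →
      HOL Ax Ψ (.all σ₁ (.all σ₂ (.all τ₂
        (φ'.subst (v2 ▹ v1 ▹ w3) ⟹ φ''.subst (v2 ▹ v0 ▹ w3) ⟹
          φ.subst (v2 ▹ .pair v1 v0 ▹ w3))))) →
      RHOL Ax Ψ t₁ (.pair t₂ u₂) φ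
  | proj₁R {Γ : Ctx} {σ₁ σ₂ τ₂ : Ty} {Ψ : Set (Form S Γ)} {t₁ : Term Γ σ₁}
      {t₂ : Term Γ (.prod σ₂ τ₂)} {φ : Form S (σ₁ :: σ₂ :: Γ)} :
      RHOL Ax Ψ t₁ t₂ (φ.subst (v0 ▹ .fst v1 ▹ w2)) → RHOL Ax Ψ t₁ (.fst t₂) φ
  | proj₂R {Γ : Ctx} {σ₁ σ₂ τ₂ : Ty} {Ψ : Set (Form S Γ)} {t₁ : Term Γ σ₁}
      {t₂ : Term Γ (.prod σ₂ τ₂)} {φ : Form S (σ₁ :: τ₂ :: Γ)} :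
      RHOL Ax Ψ t₁ t₂ (φ.subst (v0 ▹ .snd v1 ▹ w2)) → RHOL Ax Ψ t₁ (.snd t₂) φ
  /- Synchronous case rules. -/
  | boolcase {Γ : Ctx} {σ₁ σ₂ : Ty} {Ψ : Set (Form S Γ)} {t₁ t₂ : Term Γ .bool}
      {u₁ v₁ : Term Γ σ₁} {u₂ v₂ : Term Γ σ₂} {φ : Form S (σ₁ :: σ₂ :: Γ)} :
      RHOL Ax Ψ t₁ t₂ ((v0 ≐ .tt ⋏ v1 ≐ .tt) ⋎ (v0 ≐ .ff ⋏ v1 ≐ .ff)) →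
      RHOL Ax (insert (t₂ ≐ .tt) (insert (t₁ ≐ .tt) Ψ)) u₁ u₂ φ →
      RHOL Ax (insert (t₂ ≐ .ff) (insert (t₁ ≐ .ff) Ψ)) v₁ v₂ φ →
      RHOL Ax Ψ (.caseBool t₁ u₁ v₁) (.caseBool t₂ u₂ v₂) φ
  | natcase {Γ : Ctx} {σ₁ σ₂ : Ty} {Ψ : Set (Form S Γ)} {t₁ t₂ : Term Γ .nat}
      {u₁ : Term Γ σ₁} {v₁ : Term Γ (.arr .nat σ₁)}
      {u₂ : Term Γ σ₂} {v₂ : Term Γ (.arr .nat σ₂)} {φ : Form S (σ₁ :: σ₂ :: Γ)} :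
      RHOL Ax Ψ t₁ t₂ (.iff (v0 ≐ .zero) (v1 ≐ .zero)) →
      RHOL Ax (insert (t₂ ≐ .zero) (insert (t₁ ≐ .zero) Ψ)) u₁ u₂ φ →
      RHOL Ax Ψ v₁ v₂ (.natNatBranch t₁ t₂ φ) →
      RHOL Ax Ψ (.caseNat t₁ u₁ v₁) (.caseNat t₂ u₂ v₂) φ
  | listcase {Γ : Ctx} {τ₁ τ₂ σ₁ σ₂ : Ty} {Ψ : Set (Form S Γ)}
      {t₁ : Term Γ (.list τ₁)} {t₂ : Term Γ (.list τ₂)}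
      {u₁ : Term Γ σ₁} {v₁ : Term Γ (.arr τ₁ (.arr (.list τ₁) σ₁))}
      {u₂ : Term Γ σ₂} {v₂ : Term Γ (.arr τ₂ (.arr (.list τ₂) σ₂))}
      {φ : Form S (σ₁ :: σ₂ :: Γ)} :
      RHOL Ax Ψ t₁ t₂ (.iff (v0 ≐ .nil) (v1 ≐ .nil)) →
      RHOL Ax (insert (t₂ ≐ .nil) (insert (t₁ ≐ .nil) Ψ)) u₁ u₂ φ →
      RHOL Ax Ψ v₁ v₂ (.listListBranch t₁ t₂ φ) →
      RHOL Ax Ψ (.caseList t₁ u₁ v₁) (.caseList t₂ u₂ v₂) φ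
  /- One-sided case rules. -/
  | boolcaseL {Γ : Ctx} {σ₁ σ₂ : Ty} {Ψ : Set (Form S Γ)} {t₁ : Term Γ .bool}
      {u₁ v₁ : Term Γ σ₁} {t₂ : Term Γ σ₂} {φ : Form S (σ₁ :: σ₂ :: Γ)} :
      RHOL Ax (insert (t₁ ≐ .tt) Ψ) u₁ t₂ φ → RHOL Ax (insert (t₁ ≐ .ff) Ψ) v₁ t₂ φ →
      RHOL Ax Ψ (.caseBool t₁ u₁ v₁) t₂ φ
  | natcaseL {Γ : Ctx} {σ₁ σ₂ : Ty} {Ψ : Set (Form S Γ)} {t₁ : Term Γ .nat}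
      {u₁ : Term Γ σ₁} {v₁ : Term Γ (.arr .nat σ₁)} {t₂ : Term Γ σ₂}
      {φ : Form S (σ₁ :: σ₂ :: Γ)} :
      RHOL Ax (insert (t₁ ≐ .zero) Ψ) u₁ t₂ φ → RHOL Ax Ψ v₁ t₂ (.natBranchL t₁ φ) →
      RHOL Ax Ψ (.caseNat t₁ u₁ v₁) t₂ φ
  | listcaseL {Γ : Ctx} {τ σ₁ σ₂ : Ty} {Ψ : Set (Form S Γ)} {t₁ : Term Γ (.list τ)}
      {u₁ : Term Γ σ₁} {v₁ : Term Γ (.arr τ (.arr (.list τ) σ₁))} {t₂ : Term Γ σ₂}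
      {φ : Form S (σ₁ :: σ₂ :: Γ)} :
      RHOL Ax (insert (t₁ ≐ .nil) Ψ) u₁ t₂ φ → RHOL Ax Ψ v₁ t₂ (.listBranchL t₁ φ) →
      RHOL Ax Ψ (.caseList t₁ u₁ v₁) t₂ φ
  | boolcaseR {Γ : Ctx} {σ₁ σ₂ : Ty} {Ψ : Set (Form S Γ)} {t₁ : Term Γ σ₁}
      {t₂ : Term Γ .bool} {u₂ v₂ : Term Γ σ₂} {φ : Form S (σ₁ :: σ₂ :: Γ)} :
      RHOL Ax (insert (t₂ ≐ .tt) Ψ) t₁ u₂ φ → RHOL Ax (insert (t₂ ≐ .ff) Ψ) t₁ v₂ φ →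
      RHOL Ax Ψ t₁ (.caseBool t₂ u₂ v₂) φ
  | natcaseR {Γ : Ctx} {σ₁ σ₂ : Ty} {Ψ : Set (Form S Γ)} {t₁ : Term Γ σ₁}
      {t₂ : Term Γ .nat} {u₂ : Term Γ σ₂} {v₂ : Term Γ (.arr .nat σ₂)}
      {φ : Form S (σ₁ :: σ₂ :: Γ)} :
      RHOL Ax (insert (t₂ ≐ .zero) Ψ) t₁ u₂ φ → RHOL Ax Ψ t₁ v₂ (.natBranchR t₂ φ) →
      RHOL Ax Ψ t₁ (.caseNat t₂ u₂ v₂) φ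
  | listcaseR {Γ : Ctx} {τ σ₁ σ₂ : Ty} {Ψ : Set (Form S Γ)} {t₁ : Term Γ σ₁}
      {t₂ : Term Γ (.list τ)} {u₂ : Term Γ σ₂} {v₂ : Term Γ (.arr τ (.arr (.list τ) σ₂))}
      {φ : Form S (σ₁ :: σ₂ :: Γ)} :
      RHOL Ax (insert (t₂ ≐ .nil) Ψ) t₁ u₂ φ → RHOL Ax Ψ t₁ v₂ (.listBranchR t₂ φ) →
      RHOL Ax Ψ t₁ (.caseList t₂ u₂ v₂) φ
  /- Asynchronous case rules. -/
  | bbcaseA {Γ : Ctx} {σ₁ σ₂ : Ty} {Ψ : Set (Form S Γ)} {t₁ t₂ : Term Γ .bool}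
      {u₁ v₁ : Term Γ σ₁} {u₂ v₂ : Term Γ σ₂} {φ : Form S (σ₁ :: σ₂ :: Γ)} :
      RHOL Ax Ψ t₁ t₂ .top →
      RHOL Ax (insert (t₂ ≐ .tt) (insert (t₁ ≐ .tt) Ψ)) u₁ u₂ φ →
      RHOL Ax (insert (t₂ ≐ .tt) (insert (.ne t₁ .tt) Ψ)) v₁ u₂ φ →
      RHOL Ax (insert (.ne t₂ .tt) (insert (t₁ ≐ .tt) Ψ)) u₁ v₂ φ →
      RHOL Ax (insert (.ne t₂ .tt) (insert (.ne t₁ .tt) Ψ)) v₁ v₂ φ →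
      RHOL Ax Ψ (.caseBool t₁ u₁ v₁) (.caseBool t₂ u₂ v₂) φ
  | bncaseA {Γ : Ctx} {σ₁ σ₂ : Ty} {Ψ : Set (Form S Γ)} {t₁ : Term Γ .bool}
      {t₂ : Term Γ .nat} {u₁ v₁ : Term Γ σ₁} {u₂ : Term Γ σ₂} {v₂ : Term Γ (.arr .nat σ₂)}
      {φ : Form S (σ₁ :: σ₂ :: Γ)} :
      RHOL Ax Ψ t₁ t₂ .top →
      RHOL Ax (insert (t₂ ≐ .zero) (insert (t₁ ≐ .tt) Ψ)) u₁ u₂ φ →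
      RHOL Ax (insert (t₂ ≐ .zero) (insert (.ne t₁ .tt) Ψ)) v₁ u₂ φ →
      RHOL Ax (insert (t₁ ≐ .tt) Ψ) u₁ v₂ (.natBranchR t₂ φ) →
      RHOL Ax (insert (.ne t₁ .tt) Ψ) v₁ v₂ (.natBranchR t₂ φ) →
      RHOL Ax Ψ (.caseBool t₁ u₁ v₁) (.caseNat t₂ u₂ v₂) φ
  | nbcaseA {Γ : Ctx} {σ₁ σ₂ : Ty} {Ψ : Set (Form S Γ)} {t₁ : Term Γ .nat}
      {t₂ : Term Γ .bool} {u₁ : Term Γ σ₁} {v₁ : Term Γ (.arr .nat σ₁)} {u₂ v₂ : Term Γ σ₂}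
      {φ : Form S (σ₁ :: σ₂ :: Γ)} :
      RHOL Ax Ψ t₁ t₂ .top →
      RHOL Ax (insert (t₂ ≐ .tt) (insert (t₁ ≐ .zero) Ψ)) u₁ u₂ φ →
      RHOL Ax (insert (.ne t₂ .tt) (insert (t₁ ≐ .zero) Ψ)) u₁ v₂ φ →
      RHOL Ax (insert (t₂ ≐ .tt) Ψ) v₁ u₂ (.natBranchL t₁ φ) →
      RHOL Ax (insert (.ne t₂ .tt) Ψ) v₁ v₂ (.natBranchL t₁ φ) →
      RHOL Ax Ψ (.caseNat t₁ u₁ v₁) (.caseBool t₂ u₂ v₂) φ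
  | blcaseA {Γ : Ctx} {τ₂ σ₁ σ₂ : Ty} {Ψ : Set (Form S Γ)} {t₁ : Term Γ .bool}
      {t₂ : Term Γ (.list τ₂)} {u₁ v₁ : Term Γ σ₁} {u₂ : Term Γ σ₂}
      {v₂ : Term Γ (.arr τ₂ (.arr (.list τ₂) σ₂))} {φ : Form S (σ₁ :: σ₂ :: Γ)} :
      RHOL Ax Ψ t₁ t₂ .top →
      RHOL Ax (insert (t₂ ≐ .nil) (insert (t₁ ≐ .tt) Ψ)) u₁ u₂ φ →
      RHOL Ax (insert (t₂ ≐ .nil) (insert (.ne t₁ .tt) Ψ)) v₁ u₂ φ →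
      RHOL Ax (insert (t₁ ≐ .tt) Ψ) u₁ v₂ (.listBranchR t₂ φ) →
      RHOL Ax (insert (.ne t₁ .tt) Ψ) v₁ v₂ (.listBranchR t₂ φ) →
      RHOL Ax Ψ (.caseBool t₁ u₁ v₁) (.caseList t₂ u₂ v₂) φ
  | lbcaseA {Γ : Ctx} {τ₁ σ₁ σ₂ : Ty} {Ψ : Set (Form S Γ)} {t₁ : Term Γ (.list τ₁)}
      {t₂ : Term Γ .bool} {u₁ : Term Γ σ₁} {v₁ : Term Γ (.arr τ₁ (.arr (.list τ₁) σ₁))}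
      {u₂ v₂ : Term Γ σ₂} {φ : Form S (σ₁ :: σ₂ :: Γ)} :
      RHOL Ax Ψ t₁ t₂ .top →
      RHOL Ax (insert (t₂ ≐ .tt) (insert (t₁ ≐ .nil) Ψ)) u₁ u₂ φ →
      RHOL Ax (insert (.ne t₂ .tt) (insert (t₁ ≐ .nil) Ψ)) u₁ v₂ φ →
      RHOL Ax (insert (t₂ ≐ .tt) Ψ) v₁ u₂ (.listBranchL t₁ φ) →
      RHOL Ax (insert (.ne t₂ .tt) Ψ) v₁ v₂ (.listBranchL t₁ φ) →
      RHOL Ax Ψ (.caseList t₁ u₁ v₁) (.caseBool t₂ u₂ v₂) φ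
  | nncaseA {Γ : Ctx} {σ₁ σ₂ : Ty} {Ψ : Set (Form S Γ)} {t₁ t₂ : Term Γ .nat}
      {u₁ : Term Γ σ₁} {v₁ : Term Γ (.arr .nat σ₁)}
      {u₂ : Term Γ σ₂} {v₂ : Term Γ (.arr .nat σ₂)} {φ : Form S (σ₁ :: σ₂ :: Γ)} :
      RHOL Ax Ψ t₁ t₂ .top →
      RHOL Ax (insert (t₂ ≐ .zero) (insert (t₁ ≐ .zero) Ψ)) u₁ u₂ φ →
      RHOL Ax (insert (t₂ ≐ .zero) Ψ) v₁ u₂ (.natBranchL t₁ φ) →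
      RHOL Ax (insert (t₁ ≐ .zero) Ψ) u₁ v₂ (.natBranchR t₂ φ) →
      RHOL Ax Ψ v₁ v₂ (.natNatBranch t₁ t₂ φ) →
      RHOL Ax Ψ (.caseNat t₁ u₁ v₁) (.caseNat t₂ u₂ v₂) φ
  | nlcaseA {Γ : Ctx} {τ₂ σ₁ σ₂ : Ty} {Ψ : Set (Form S Γ)} {t₁ : Term Γ .nat}
      {t₂ : Term Γ (.list τ₂)} {u₁ : Term Γ σ₁} {v₁ : Term Γ (.arr .nat σ₁)}
      {u₂ : Term Γ σ₂} {v₂ : Term Γ (.arr τ₂ (.arr (.list τ₂) σ₂))}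
      {φ : Form S (σ₁ :: σ₂ :: Γ)} :
      RHOL Ax Ψ t₁ t₂ .top →
      RHOL Ax (insert (t₂ ≐ .nil) (insert (t₁ ≐ .zero) Ψ)) u₁ u₂ φ →
      RHOL Ax (insert (t₂ ≐ .nil) Ψ) v₁ u₂ (.natBranchL t₁ φ) →
      RHOL Ax (insert (t₁ ≐ .zero) Ψ) u₁ v₂ (.listBranchR t₂ φ) →
      RHOL Ax Ψ v₁ v₂ (.natListBranch t₁ t₂ φ) →
      RHOL Ax Ψ (.caseNat t₁ u₁ v₁) (.caseList t₂ u₂ v₂) φ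
  | lncaseA {Γ : Ctx} {τ₁ σ₁ σ₂ : Ty} {Ψ : Set (Form S Γ)} {t₁ : Term Γ (.list τ₁)}
      {t₂ : Term Γ .nat} {u₁ : Term Γ σ₁} {v₁ : Term Γ (.arr τ₁ (.arr (.list τ₁) σ₁))}
      {u₂ : Term Γ σ₂} {v₂ : Term Γ (.arr .nat σ₂)} {φ : Form S (σ₁ :: σ₂ :: Γ)} :
      RHOL Ax Ψ t₁ t₂ .top →
      RHOL Ax (insert (t₂ ≐ .zero) (insert (t₁ ≐ .nil) Ψ)) u₁ u₂ φ →
      RHOL Ax (insert (t₂ ≐ .zero) Ψ) v₁ u₂ (.listBranchL t₁ φ) →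
      RHOL Ax (insert (t₁ ≐ .nil) Ψ) u₁ v₂ (.natBranchR t₂ φ) →
      RHOL Ax Ψ v₁ v₂ (.listNatBranch t₁ t₂ φ) →
      RHOL Ax Ψ (.caseList t₁ u₁ v₁) (.caseNat t₂ u₂ v₂) φ
  | llcaseA {Γ : Ctx} {τ₁ τ₂ σ₁ σ₂ : Ty} {Ψ : Set (Form S Γ)}
      {t₁ : Term Γ (.list τ₁)} {t₂ : Term Γ (.list τ₂)}
      {u₁ : Term Γ σ₁} {v₁ : Term Γ (.arr τ₁ (.arr (.list τ₁) σ₁))}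
      {u₂ : Term Γ σ₂} {v₂ : Term Γ (.arr τ₂ (.arr (.list τ₂) σ₂))}
      {φ : Form S (σ₁ :: σ₂ :: Γ)} :
      RHOL Ax Ψ t₁ t₂ .top →
      RHOL Ax (insert (t₂ ≐ .nil) (insert (t₁ ≐ .nil) Ψ)) u₁ u₂ φ →
      RHOL Ax (insert (t₂ ≐ .nil) Ψ) v₁ u₂ (.listBranchL t₁ φ) →
      RHOL Ax (insert (t₁ ≐ .nil) Ψ) u₁ v₂ (.listBranchR t₂ φ) →
      RHOL Ax Ψ v₁ v₂ (.listListBranch t₁ t₂ φ) →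
      RHOL Ax Ψ (.caseList t₁ u₁ v₁) (.caseList t₂ u₂ v₂) φ
  /- Alternative synchronous case rules. -/
  | natcaseStar {Γ : Ctx} {σ₁ σ₂ : Ty} {Ψ : Set (Form S Γ)} {t₁ t₂ : Term Γ .nat}
      {u₁ : Term Γ σ₁} {v₁ : Term Γ (.arr .nat σ₁)}
      {u₂ : Term Γ σ₂} {v₂ : Term Γ (.arr .nat σ₂)}
      {φ' : Form S (.nat :: .nat :: Γ)} {φ : Form S (σ₁ :: σ₂ :: Γ)} :
      RHOL Ax Ψ t₁ t₂ (φ' ⋏ .iff (v0 ≐ .zero) (v1 ≐ .zero)) →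
      RHOL Ax (insert (φ'.subst (.zero ▹ .zero ▹ w0)) Ψ) u₁ u₂ φ →
      RHOL Ax Ψ v₁ v₂ (.all .nat (.all .nat (φ'.subst (.succ v1 ▹ .succ v0 ▹ w4) ⟹
        φ.subst (.app v2 v1 ▹ .app v3 v0 ▹ w4)))) →
      RHOL Ax Ψ (.caseNat t₁ u₁ v₁) (.caseNat t₂ u₂ v₂) φ
  | listcaseStar {Γ : Ctx} {τ₁ τ₂ σ₁ σ₂ : Ty} {Ψ : Set (Form S Γ)}
      {t₁ : Term Γ (.list τ₁)} {t₂ : Term Γ (.list τ₂)}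
      {u₁ : Term Γ σ₁} {v₁ : Term Γ (.arr τ₁ (.arr (.list τ₁) σ₁))}
      {u₂ : Term Γ σ₂} {v₂ : Term Γ (.arr τ₂ (.arr (.list τ₂) σ₂))}
      {φ' : Form S (.list τ₁ :: .list τ₂ :: Γ)} {φ : Form S (σ₁ :: σ₂ :: Γ)} :
      RHOL Ax Ψ t₁ t₂ (φ' ⋏ .iff (v0 ≐ .nil) (v1 ≐ .nil)) →
      RHOL Ax (insert (φ'.subst (.nil ▹ .nil ▹ w0)) Ψ) u₁ u₂ φ →
      RHOL Ax Ψ v₁ v₂ (.all τ₁ (.all τ₂ (.all (.list τ₁) (.all (.list τ₂)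
        (φ'.subst (.cons v3 v1 ▹ .cons v2 v0 ▹ w6) ⟹
          φ.subst (.app (.app v4 v3) v1 ▹ .app (.app v5 v2) v0 ▹ w6)))))) →
      RHOL Ax Ψ (.caseList t₁ u₁ v₁) (.caseList t₂ u₂ v₂) φ
  /- Recursion. The premise of `letrec` lives in the context `Γ, f₂, f₁, x₂, x₁`, with `x₁`,
  `x₂`, `f₁`, `f₂` as `v0`, `v1`, `v2`, `v3`; under `∀ m₁ m₂` all indices are two higher. -/
  | letrec {Γ : Ctx} {ι₁ ι₂ σ₁ σ₂ : Ty} {Ψ : Set (Form S Γ)} (h₁ : IsInd ι₁) (h₂ : IsInd ι₂)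
      {e₁ : Term (ι₁ :: .arr ι₁ σ₁ :: Γ) σ₁} {e₂ : Term (ι₂ :: .arr ι₂ σ₂ :: Γ) σ₂}
      (he₁ : WellDef e₁.1) (he₂ : WellDef e₂.1)
      {φ' : Form S (ι₁ :: ι₂ :: Γ)} {φ : Form S (σ₁ :: σ₂ :: ι₁ :: ι₂ :: Γ)} :
      RHOL Ax
        (insert (.all ι₁ (.all ι₂ (.sizeLt₂ h₁ h₂ v1 v0 v2 v3 ⟹
            φ'.subst (v1 ▹ v0 ▹ w6) ⟹
            φ.subst (.app v4 v1 ▹ .app v5 v0 ▹ v1 ▹ v0 ▹ w6))))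
          (insert (φ'.subst (v0 ▹ v1 ▹ w4)) (wk4 Ψ)))
        (e₁.subst (v0 ▹ v2 ▹ w4)) (e₂.subst (v1 ▹ v3 ▹ w4))
        (φ.subst (v0 ▹ v1 ▹ v2 ▹ v3 ▹ w6)) →
      RHOL Ax Ψ (.letrec h₁ e₁ he₁) (.letrec h₂ e₂ he₂) (.arrow₂ φ' φ)
  | letrecL {Γ : Ctx} {ι₁ σ₁ σ₂ : Ty} {Ψ : Set (Form S Γ)} (h₁ : IsInd ι₁)
      {e₁ : Term (ι₁ :: .arr ι₁ σ₁ :: Γ) σ₁} (he₁ : WellDef e₁.1) {t₂ : Term Γ σ₂}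
      {φ' : Form S (ι₁ :: Γ)} {φ : Form S (σ₁ :: σ₂ :: ι₁ :: Γ)} :
      RHOL Ax
        (insert (.all ι₁ (.sizeLt h₁ v0 v1 ⟹ φ'.subst (v0 ▹ w3) ⟹
            φ.subst (.app v2 v0 ▹ t₂.subst w3 ▹ v0 ▹ w3)))
          (insert (φ'.subst (v0 ▹ w2)) (wk2 Ψ)))
        e₁ (t₂.subst w2) (φ.subst (v0 ▹ v1 ▹ v2 ▹ w4)) →
      RHOL Ax Ψ (.letrec h₁ e₁ he₁) t₂ (.arrowL φ' φ)
  | letrecR {Γ : Ctx} {ι₂ σ₁ σ₂ : Ty} {Ψ : Set (Form S Γ)} (h₂ : IsInd ι₂) {t₁ : Term Γ σ₁}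
      {e₂ : Term (ι₂ :: .arr ι₂ σ₂ :: Γ) σ₂} (he₂ : WellDef e₂.1)
      {φ' : Form S (ι₂ :: Γ)} {φ : Form S (σ₁ :: σ₂ :: ι₂ :: Γ)} :
      RHOL Ax
        (insert (.all ι₂ (.sizeLt h₂ v0 v1 ⟹ φ'.subst (v0 ▹ w3) ⟹
            φ.subst (t₁.subst w3 ▹ .app v2 v0 ▹ v0 ▹ w3)))
          (insert (φ'.subst (v0 ▹ w2)) (wk2 Ψ)))
        (t₁.subst w2) e₂ (φ.subst (v0 ▹ v1 ▹ v2 ▹ w4)) →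
      RHOL Ax Ψ t₁ (.letrec h₂ e₂ he₂) (.arrowR φ' φ)

end RelHOL

namespace RelHOL

/-! ### Composition of substitutions -/

/-! Soundness is proved by induction on derivations, for HOL, then UHOL, then RHOL: each rule turns
a truth about premises into a truth about the conclusion in the set-theoretic model. The
substitution lemma for assertions (`Form.holds_subst`) converts every substituted assertion in a
rule into the same assertion at another valuation, after which most rules become elementary facts
about functions, pairs, numbers and lists. The recursion rules follow by strong induction on sizes,
since a legal `letrec` satisfies its fixpoint equation.

The one deep point is the conversion rule. Conversion is the equivalence closure of reduction on raw
terms, so a path between two legal terms may pass through terms whose recursive definitions are not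
well-founded; there `letrec` has an arbitrary default value and unfolding need not preserve meaning.
Legality can be lost by expanding, for instance by adding a bad component that a projection
discards, but not by reducing. Hence the path is replaced by two forward reductions to a common
reduct: confluence comes from parallel reduction and developments (`Par.exists_development`,
`Conv.join`), and `Par.legal_den` shows that forward reduction keeps both legality and value.
Together they give `Conv.den_eq`.

Consistency is soundness for `bot`: every type is inhabited, so every context has a valuation. -/

theorem TmSub.lift_s {Γ Δ : Ctx} {σ τ : Ty} (θ : TmSub Γ Δ) (x : Var Γ τ) :
    TmSub.lift (σ := σ) θ τ (.s x) = (θ τ x).rename fun _ => .s := rfl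

/-- The four composition laws must be proved in this order. Under a binder a substitution weakens
its terms by renaming, so commuting a substitution with a renaming uses this law, and composing two
substitutions uses both mixed laws. -/
theorem Tm.rename_rename {Γ : Ctx} {τ : Ty} (t : Tm Γ τ) :
    ∀ {Δ Θ : Ctx} (r : Ren Γ Δ) (s : Ren Δ Θ),
      (t.rename r).rename s = t.rename fun τ x => s τ (r τ x) := by
  have hl : ∀ {Γ Δ Θ : Ctx} {σ : Ty} (r : Ren Γ Δ) (s : Ren Δ Θ),
      (fun τ x => s.lift τ (r.lift τ x) : Ren (σ :: Γ) (σ :: Θ)) =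
        Ren.lift fun τ x => s τ (r τ x) := by
    intro Γ Δ Θ σ r s
    funext τ x
    cases x <;> rfl
  induction t <;> intro Δ Θ r s <;> simp_all [Tm.rename]

theorem Tm.subst_rename {Γ : Ctx} {τ : Ty} (t : Tm Γ τ) :
    ∀ {Δ Θ : Ctx} (r : Ren Γ Δ) (θ : TmSub Δ Θ),
      (t.rename r).subst θ = t.subst fun τ x => θ τ (r τ x) := by
  have hl : ∀ {Γ Δ Θ : Ctx} {σ : Ty} (r : Ren Γ Δ) (θ : TmSub Δ Θ),
      (fun τ x => θ.lift τ (r.lift τ x) : TmSub (σ :: Γ) (σ :: Θ)) =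
        TmSub.lift fun τ x => θ τ (r τ x) := by
    intro Γ Δ Θ σ r θ
    funext τ x
    cases x <;> rfl
  induction t <;> intro Δ Θ r θ <;> simp_all [Tm.rename, Tm.subst]

theorem Tm.rename_subst {Γ : Ctx} {τ : Ty} (t : Tm Γ τ) :
    ∀ {Δ Θ : Ctx} (θ : TmSub Γ Δ) (r : Ren Δ Θ),
      (t.subst θ).rename r = t.subst fun τ x => (θ τ x).rename r := by
  have hl : ∀ {Γ Δ Θ : Ctx} {σ : Ty} (θ : TmSub Γ Δ) (r : Ren Δ Θ),
      (fun τ x => (θ.lift τ x).rename r.lift : TmSub (σ :: Γ) (σ :: Θ)) =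
        TmSub.lift fun τ x => (θ τ x).rename r := by
    intro Γ Δ Θ σ θ r
    funext τ x
    cases x with
    | z => rfl
    | s y =>
      exact (Tm.rename_rename (θ τ y) (fun _ => .s) r.lift).trans
        (Tm.rename_rename (θ τ y) r fun _ => .s).symm
  induction t <;> intro Δ Θ θ r <;> simp_all [Tm.rename, Tm.subst]

theorem TmSub.lift_comp {Γ Δ Θ : Ctx} {σ : Ty} (θ : TmSub Γ Δ) (η : TmSub Δ Θ) :
    (fun τ x => (θ.lift τ x).subst η.lift : TmSub (σ :: Γ) (σ :: Θ)) =
      TmSub.lift fun τ x => (θ τ x).subst η := by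
  funext τ x
  cases x with
  | z => rfl
  | s y =>
    exact (Tm.subst_rename (θ τ y) (fun _ => .s) η.lift).trans
      (Tm.rename_subst (θ τ y) η fun _ => .s).symm

theorem Tm.subst_subst {Γ : Ctx} {τ : Ty} (t : Tm Γ τ) :
    ∀ {Δ Θ : Ctx} (θ : TmSub Γ Δ) (η : TmSub Δ Θ),
      (t.subst θ).subst η = t.subst fun τ x => (θ τ x).subst η := by
  induction t <;> intro Δ Θ θ η <;> simp_all [Tm.subst, TmSub.lift_comp]

theorem TmSub.lift_id {Γ : Ctx} {σ : Ty} : TmSub.lift (σ := σ) (TmSub.id (Γ := Γ)) = TmSub.id := by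
  funext τ x
  cases x <;> rfl

theorem Tm.subst_id {Γ : Ctx} {τ : Ty} (t : Tm Γ τ) : t.subst TmSub.id = t := by
  induction t <;> simp_all [Tm.subst, TmSub.lift_id]
  rfl

/-- With renaming seen as substitution of variables, a single induction on parallel reduction serves
both operations. -/
theorem Tm.rename_eq_subst {Γ Δ : Ctx} {τ : Ty} (t : Tm Γ τ) (r : Ren Γ Δ) :
    t.rename r = t.subst fun τ x => .var (r τ x) := by
  have := Tm.rename_subst t TmSub.id r
  rwa [Tm.subst_id] at this

theorem TmSub.comp_cons {Γ Δ Θ : Ctx} {σ : Ty} (t : Tm Δ σ) (θ : TmSub Γ Δ) (η : TmSub Δ Θ) :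
    (fun τ x => (TmSub.cons t θ τ x).subst η) =
      TmSub.cons (t.subst η) fun τ x => (θ τ x).subst η := by
  funext τ x
  cases x <;> rfl

/-- The weakening inserted by `lift` is cancelled by instantiating the bound variable. This is the
heart of both substitution lemmas below. -/
theorem TmSub.lift_comp_cons {Γ Δ Θ : Ctx} {σ : Ty} (θ : TmSub Γ Δ) (t : Tm Θ σ)
    (η : TmSub Δ Θ) :
    (fun τ x => (θ.lift τ x).subst (TmSub.cons t η)) =
      TmSub.cons t fun τ x => (θ τ x).subst η := by
  funext τ x
  cases x with
  | z => rfl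
  | s y => exact Tm.subst_rename (θ τ y) (fun _ => .s) (TmSub.cons t η)

/-- The substitution lemma for one variable. -/
theorem Tm.subst_cons_subst {Γ Δ : Ctx} {σ τ : Ty} (t : Tm (σ :: Γ) τ) (u : Tm Γ σ)
    (θ : TmSub Γ Δ) :
    (t.subst (TmSub.cons u TmSub.id)).subst θ =
      (t.subst θ.lift).subst (TmSub.cons (u.subst θ) TmSub.id) := by
  simp only [Tm.subst_subst, TmSub.comp_cons, TmSub.lift_comp_cons]
  -- Both sides now substitute once in `t`; on the outer variables the right side still carries a
  -- trailing identity substitution.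
  simp only [show ∀ τ x, (θ τ x).subst TmSub.id = θ τ x from fun _ _ => Tm.subst_id _]
  rfl

/-- The substitution lemma for two variables. -/
theorem Tm.subst_cons_cons_subst {Γ Δ : Ctx} {σ σ' τ : Ty} (t : Tm (σ :: σ' :: Γ) τ)
    (u : Tm Γ σ) (u' : Tm Γ σ') (θ : TmSub Γ Δ) :
    (t.subst (TmSub.cons u (TmSub.cons u' TmSub.id))).subst θ =
      (t.subst θ.lift.lift).subst
        (TmSub.cons (u.subst θ) (TmSub.cons (u'.subst θ) TmSub.id)) := by
  simp only [Tm.subst_subst, TmSub.comp_cons, TmSub.lift_comp_cons]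
  simp only [show ∀ τ x, (θ τ x).subst TmSub.id = θ τ x from fun _ _ => Tm.subst_id _]
  rfl

/-! ### Parallel reduction and confluence -/

/-- Parallel `βιμ`-reduction; a contracted redex may have been created by the reduction of
its components. -/
inductive Par : {Γ : Ctx} → {τ : Ty} → Tm Γ τ → Tm Γ τ → Prop
  | var {Γ : Ctx} {τ : Ty} (x : Var Γ τ) : Par (.var x) (.var x)
  | pair {Γ : Ctx} {σ τ : Ty} {t t' : Tm Γ σ} {u u' : Tm Γ τ} :
      Par t t' → Par u u' → Par (.pair t u) (.pair t' u')
  | fst {Γ : Ctx} {σ τ : Ty} {t t' : Tm Γ (.prod σ τ)} : Par t t' → Par (.fst t) (.fst t')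
  | snd {Γ : Ctx} {σ τ : Ty} {t t' : Tm Γ (.prod σ τ)} : Par t t' → Par (.snd t) (.snd t')
  | app {Γ : Ctx} {σ τ : Ty} {t t' : Tm Γ (.arr σ τ)} {u u' : Tm Γ σ} :
      Par t t' → Par u u' → Par (.app t u) (.app t' u')
  | lam {Γ : Ctx} {σ τ : Ty} {t t' : Tm (σ :: Γ) τ} : Par t t' → Par (.lam t) (.lam t')
  | tt {Γ : Ctx} : Par (.tt : Tm Γ _) .tt
  | ff {Γ : Ctx} : Par (.ff : Tm Γ _) .ff
  | zero {Γ : Ctx} : Par (.zero : Tm Γ _) .zero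
  | succ {Γ : Ctx} {t t' : Tm Γ .nat} : Par t t' → Par (.succ t) (.succ t')
  | nil {Γ : Ctx} {τ : Ty} : Par (.nil : Tm Γ (.list τ)) .nil
  | cons {Γ : Ctx} {τ : Ty} {t t' : Tm Γ τ} {u u' : Tm Γ (.list τ)} :
      Par t t' → Par u u' → Par (.cons t u) (.cons t' u')
  | caseBool {Γ : Ctx} {σ : Ty} {t t' : Tm Γ .bool} {u u' v v' : Tm Γ σ} :
      Par t t' → Par u u' → Par v v' → Par (.caseBool t u v) (.caseBool t' u' v')
  | caseNat {Γ : Ctx} {σ : Ty} {t t' : Tm Γ .nat} {u u' : Tm Γ σ} {v v' : Tm Γ (.arr .nat σ)} :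
      Par t t' → Par u u' → Par v v' → Par (.caseNat t u v) (.caseNat t' u' v')
  | caseList {Γ : Ctx} {τ σ : Ty} {t t' : Tm Γ (.list τ)} {u u' : Tm Γ σ}
      {v v' : Tm Γ (.arr τ (.arr (.list τ) σ))} :
      Par t t' → Par u u' → Par v v' → Par (.caseList t u v) (.caseList t' u' v')
  | letrec {Γ : Ctx} {ι σ : Ty} (hι : IsInd ι) {e e' : Tm (ι :: .arr ι σ :: Γ) σ} :
      Par e e' → Par (.letrec hι e) (.letrec hι e')
  -- Asking only that the head reduces to an abstraction lets a development be read off the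
  -- developments of the immediate subterms, without inspecting those subterms.
  | beta {Γ : Ctx} {σ τ : Ty} {t : Tm Γ (.arr σ τ)} {b : Tm (σ :: Γ) τ} {u u' : Tm Γ σ} :
      Par t (.lam b) → Par u u' → Par (.app t u) (b.subst (TmSub.cons u' TmSub.id))
  | beta_fst {Γ : Ctx} {σ τ : Ty} {t : Tm Γ (.prod σ τ)} {a : Tm Γ σ} {b : Tm Γ τ} :
      Par t (.pair a b) → Par (.fst t) a
  | beta_snd {Γ : Ctx} {σ τ : Ty} {t : Tm Γ (.prod σ τ)} {a : Tm Γ σ} {b : Tm Γ τ} :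
      Par t (.pair a b) → Par (.snd t) b
  | iota_tt {Γ : Ctx} {σ : Ty} {t : Tm Γ .bool} {u u' : Tm Γ σ} (v : Tm Γ σ) :
      Par t .tt → Par u u' → Par (.caseBool t u v) u'
  | iota_ff {Γ : Ctx} {σ : Ty} {t : Tm Γ .bool} (u : Tm Γ σ) {v v' : Tm Γ σ} :
      Par t .ff → Par v v' → Par (.caseBool t u v) v'
  | iota_zero {Γ : Ctx} {σ : Ty} {t : Tm Γ .nat} {u u' : Tm Γ σ} (v : Tm Γ (.arr .nat σ)) :
      Par t .zero → Par u u' → Par (.caseNat t u v) u'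
  | iota_succ {Γ : Ctx} {σ : Ty} {t n : Tm Γ .nat} (u : Tm Γ σ) {v v' : Tm Γ (.arr .nat σ)} :
      Par t (.succ n) → Par v v' → Par (.caseNat t u v) (.app v' n)
  | iota_nil {Γ : Ctx} {τ σ : Ty} {t : Tm Γ (.list τ)} {u u' : Tm Γ σ}
      (v : Tm Γ (.arr τ (.arr (.list τ) σ))) :
      Par t .nil → Par u u' → Par (.caseList t u v) u'
  | iota_cons {Γ : Ctx} {τ σ : Ty} {t : Tm Γ (.list τ)} {a : Tm Γ τ} {l : Tm Γ (.list τ)}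
      (u : Tm Γ σ) {v v' : Tm Γ (.arr τ (.arr (.list τ) σ))} :
      Par t (.cons a l) → Par v v' → Par (.caseList t u v) (.app (.app v' a) l)
  | mu {Γ : Ctx} {ι σ : Ty} {hι : IsInd ι} {t : Tm Γ (.arr ι σ)}
      {e : Tm (ι :: .arr ι σ :: Γ) σ} {u c : Tm Γ ι} :
      Par t (.letrec hι e) → Par u c → c.IsCon →
      Par (.app t u) (e.subst (TmSub.cons c (TmSub.cons (.letrec hι e) TmSub.id)))

theorem Par.refl {Γ : Ctx} {τ : Ty} (t : Tm Γ τ) : Par t t := by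
  induction t <;> constructor <;> assumption

theorem Tm.IsCon.subst {Γ Δ : Ctx} {τ : Ty} {t : Tm Γ τ} (h : t.IsCon) (θ : TmSub Γ Δ) :
    (t.subst θ).IsCon := by
  cases h <;> constructor

/-- No reduction happens at a constructor head, so a `mu` redex stays a redex when its argument is
reduced further. -/
theorem Tm.IsCon.par {Γ : Ctx} {τ : Ty} {t t' : Tm Γ τ} (h : t.IsCon) (ht : Par t t') :
    t'.IsCon := by
  cases h <;> cases ht <;> constructor

/-- Parallel reduction is closed under substitutions taken from a class of pairs that are
related pointwise and that is stable under binders. -/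
theorem Par.subst_of_class (K : ∀ {Γ Δ : Ctx}, TmSub Γ Δ → TmSub Γ Δ → Prop)
    (hK : ∀ {Γ Δ : Ctx} {θ θ' : TmSub Γ Δ}, K θ θ' → ∀ σ x, Par (θ σ x) (θ' σ x))
    (hl : ∀ {Γ Δ : Ctx} {σ : Ty} {θ θ' : TmSub Γ Δ}, K θ θ' →
      K (TmSub.lift (σ := σ) θ) (TmSub.lift θ'))
    {Γ : Ctx} {τ : Ty} {t t' : Tm Γ τ} (h : Par t t') :
    ∀ {Δ : Ctx} {θ θ' : TmSub Γ Δ}, K θ θ' → Par (t.subst θ) (t'.subst θ') := by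
  induction h <;> intro Δ θ θ' hθ
  case var x => exact hK hθ _ x
  case beta ih₁ ih₂ =>
    -- The substituted contractum has to be recognised as the contractum of the substituted redex.
    rw [Tm.subst_cons_subst]
    exact .beta (ih₁ hθ) (ih₂ hθ)
  case mu hc ih₁ ih₂ =>
    rw [Tm.subst_cons_cons_subst]
    exact .mu (ih₁ hθ) (ih₂ hθ) (hc.subst θ')
  case lam ih => exact .lam (ih (hl hθ))
  case letrec ih => exact .letrec _ (ih (hl (hl hθ)))
  case beta_fst ih => exact .beta_fst (ih hθ)
  case beta_snd ih => exact .beta_snd (ih hθ)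
  case iota_tt ih₁ ih₂ => exact .iota_tt _ (ih₁ hθ) (ih₂ hθ)
  case iota_ff ih₁ ih₂ => exact .iota_ff _ (ih₁ hθ) (ih₂ hθ)
  case iota_zero ih₁ ih₂ => exact .iota_zero _ (ih₁ hθ) (ih₂ hθ)
  case iota_succ ih₁ ih₂ => exact .iota_succ _ (ih₁ hθ) (ih₂ hθ)
  case iota_nil ih₁ ih₂ => exact .iota_nil _ (ih₁ hθ) (ih₂ hθ)
  case iota_cons ih₁ ih₂ => exact .iota_cons _ (ih₁ hθ) (ih₂ hθ)
  all_goals constructor <;> solve_by_elim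

/-- First use of the class: pairs `(θ, θ)` with `θ` a renaming. Such pairs are related by
reflexivity and are stable under binders through `Ren.lift`, so nothing about reducing weakened
terms is presupposed. -/
theorem Par.rename {Γ Δ : Ctx} {τ : Ty} {t t' : Tm Γ τ} (h : Par t t') (r : Ren Γ Δ) :
    Par (t.rename r) (t'.rename r) := by
  rw [Tm.rename_eq_subst, Tm.rename_eq_subst]
  refine Par.subst_of_class
    (fun {Γ Δ} θ θ' => θ = θ' ∧ ∃ r : Ren Γ Δ, θ = fun τ x => .var (r τ x)) ?_ ?_ h ⟨rfl, r, rfl⟩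
  · rintro Γ Δ θ θ' ⟨rfl, -⟩ σ x
    exact .refl _
  · rintro Γ Δ σ θ θ' ⟨rfl, r, rfl⟩
    refine ⟨rfl, r.lift, ?_⟩
    funext τ x
    cases x <;> rfl

/-- Second use of the class: all pointwise related pairs. Stability under binders is now exactly
closure under weakening, that is, `Par.rename`. -/
theorem Par.subst {Γ Δ : Ctx} {τ : Ty} {t t' : Tm Γ τ} (h : Par t t') {θ θ' : TmSub Γ Δ}
    (hθ : ∀ σ x, Par (θ σ x) (θ' σ x)) : Par (t.subst θ) (t'.subst θ') := by
  refine Par.subst_of_class (fun θ θ' => ∀ σ x, Par (θ σ x) (θ' σ x)) (fun h => h) ?_ h hθ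
  intro Γ Δ σ θ θ' h τ x
  cases x with
  | z => exact .refl _
  | s y => exact (h _ y).rename _

theorem Par.subst_cons {Γ : Ctx} {σ τ : Ty} {t t' : Tm (σ :: Γ) τ} {u u' : Tm Γ σ}
    (h : Par t t') (hu : Par u u') :
    Par (t.subst (TmSub.cons u TmSub.id)) (t'.subst (TmSub.cons u' TmSub.id)) := by
  refine h.subst fun τ x => ?_
  cases x with
  | z => exact hu
  | s y => exact .refl _

theorem Par.subst_cons_cons {Γ : Ctx} {σ σ' τ : Ty} {t t' : Tm (σ :: σ' :: Γ) τ}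
    {u u' : Tm Γ σ} {v v' : Tm Γ σ'} (h : Par t t') (hu : Par u u') (hv : Par v v') :
    Par (t.subst (TmSub.cons u (TmSub.cons v TmSub.id)))
      (t'.subst (TmSub.cons u' (TmSub.cons v' TmSub.id))) := by
  refine h.subst fun τ x => ?_
  rcases x with _ | _ | y
  · exact hu
  · exact hv
  · exact .refl _

/-- Every term has a complete development. -/
theorem Par.exists_development {Γ : Ctx} {τ : Ty} (t : Tm Γ τ) :
    ∃ d, ∀ u, Par t u → Par u d := by
  induction t with
  | var x => exact ⟨_, fun u h => by cases h; exact .refl _⟩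
  | tt => exact ⟨_, fun u h => by cases h; exact .refl _⟩
  | ff => exact ⟨_, fun u h => by cases h; exact .refl _⟩
  | zero => exact ⟨_, fun u h => by cases h; exact .refl _⟩
  | nil => exact ⟨_, fun u h => by cases h; exact .refl _⟩
  | pair t u iht ihu =>
    obtain ⟨d, hd⟩ := iht
    obtain ⟨d', hd'⟩ := ihu
    exact ⟨.pair d d', fun _ h => by cases h with | pair h h' => exact .pair (hd _ h) (hd' _ h')⟩
  | cons t u iht ihu =>
    obtain ⟨d, hd⟩ := iht
    obtain ⟨d', hd'⟩ := ihu
    exact ⟨.cons d d', fun _ h => by cases h with | cons h h' => exact .cons (hd _ h) (hd' _ h')⟩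
  | succ t ih =>
    obtain ⟨d, hd⟩ := ih
    exact ⟨.succ d, fun _ h => by cases h with | succ h => exact .succ (hd _ h)⟩
  | lam t ih =>
    obtain ⟨d, hd⟩ := ih
    exact ⟨.lam d, fun _ h => by cases h with | lam h => exact .lam (hd _ h)⟩
  | letrec hι e ih =>
    obtain ⟨d, hd⟩ := ih
    exact ⟨.letrec hι d, fun _ h => by cases h with | letrec _ h => exact .letrec _ (hd _ h)⟩
  | fst t ih =>
    obtain ⟨d, hd⟩ := ih
    -- Every one-step reduct of `t` reduces to `d`, and pairs reduce only to pairs. So if some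
    -- reduct of `t` is a pair, then `d` is a pair and its components are reached from those of the
    -- reduct. The same dichotomy on the development of the principal subterm decides all
    -- elimination forms below.
    by_cases hp : ∃ a b, d = .pair a b
    · obtain ⟨a, b, rfl⟩ := hp
      refine ⟨a, fun u h => ?_⟩
      cases h with
      | fst h => exact .beta_fst (hd _ h)
      | beta_fst h => cases hd _ h with | pair h _ => exact h
    · refine ⟨.fst d, fun u h => ?_⟩
      cases h with
      | fst h => exact .fst (hd _ h)
      | beta_fst h => cases hd _ h with | pair _ _ => exact absurd ⟨_, _, rfl⟩ hp
  | snd t ih =>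
    obtain ⟨d, hd⟩ := ih
    by_cases hp : ∃ a b, d = .pair a b
    · obtain ⟨a, b, rfl⟩ := hp
      refine ⟨b, fun u h => ?_⟩
      cases h with
      | snd h => exact .beta_snd (hd _ h)
      | beta_snd h => cases hd _ h with | pair _ h => exact h
    · refine ⟨.snd d, fun u h => ?_⟩
      cases h with
      | snd h => exact .snd (hd _ h)
      | beta_snd h => cases hd _ h with | pair _ _ => exact absurd ⟨_, _, rfl⟩ hp
  | app t u iht ihu =>
    obtain ⟨d, hd⟩ := iht
    obtain ⟨c, hc⟩ := ihu
    by_cases hb : ∃ b, d = .lam b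
    · obtain ⟨b, rfl⟩ := hb
      refine ⟨b.subst (TmSub.cons c TmSub.id), fun w h => ?_⟩
      cases h with
      | app h h' => exact .beta (hd _ h) (hc _ h')
      | beta h h' => cases hd _ h with | lam h => exact h.subst_cons (hc _ h')
      -- A `letrec` never reduces to an abstraction, so a `mu` contraction cannot coexist with an
      -- abstraction as the development of the head.
      | mu h h' _ => cases hd _ h
    -- The constructor test is made on the development `c` of the argument: if any reduct of the
    -- argument has a constructor head, then so does `c`.
    by_cases hm : c.IsCon ∧ ∃ hι e, d = .letrec hι e
    · obtain ⟨hcon, hι, e, rfl⟩ := hm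
      refine ⟨e.subst (TmSub.cons c (TmSub.cons (.letrec hι e) TmSub.id)), fun w h => ?_⟩
      cases h with
      | app h h' => exact .mu (hd _ h) (hc _ h') hcon
      | beta h h' => cases hd _ h
      | mu h h' _ =>
        cases hd _ h with | letrec _ h => exact h.subst_cons_cons (hc _ h') (.letrec _ h)
    · refine ⟨.app d c, fun w h => ?_⟩
      cases h with
      | app h h' => exact .app (hd _ h) (hc _ h')
      | beta h h' => cases hd _ h with | lam _ => exact absurd ⟨_, rfl⟩ hb
      | mu h h' h'' =>
        cases hd _ h with | letrec _ _ => exact absurd ⟨h''.par (hc _ h'), _, _, rfl⟩ hm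
  | caseBool t u v iht ihu ihv =>
    obtain ⟨d, hd⟩ := iht
    obtain ⟨a, ha⟩ := ihu
    obtain ⟨b, hb⟩ := ihv
    by_cases h₁ : d = .tt
    · subst h₁
      refine ⟨a, fun w h => ?_⟩
      cases h with
      | caseBool h h' _ => exact .iota_tt _ (hd _ h) (ha _ h')
      | iota_tt _ _ h => exact ha _ h
      | iota_ff _ h _ => cases hd _ h
    by_cases h₂ : d = .ff
    · subst h₂
      refine ⟨b, fun w h => ?_⟩
      cases h with
      | caseBool h _ h' => exact .iota_ff _ (hd _ h) (hb _ h')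
      | iota_tt _ h _ => cases hd _ h
      | iota_ff _ _ h => exact hb _ h
    · refine ⟨.caseBool d a b, fun w h => ?_⟩
      cases h with
      | caseBool h h' h'' => exact .caseBool (hd _ h) (ha _ h') (hb _ h'')
      | iota_tt _ h _ => cases hd _ h; exact absurd rfl h₁
      | iota_ff _ h _ => cases hd _ h; exact absurd rfl h₂
  | caseNat t u v iht ihu ihv =>
    obtain ⟨d, hd⟩ := iht
    obtain ⟨a, ha⟩ := ihu
    obtain ⟨b, hb⟩ := ihv
    by_cases h₁ : d = .zero
    · subst h₁
      refine ⟨a, fun w h => ?_⟩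
      cases h with
      | caseNat h h' _ => exact .iota_zero _ (hd _ h) (ha _ h')
      | iota_zero _ _ h => exact ha _ h
      | iota_succ _ h _ => cases hd _ h
    by_cases h₂ : ∃ n, d = .succ n
    · obtain ⟨n, rfl⟩ := h₂
      refine ⟨.app b n, fun w h => ?_⟩
      cases h with
      | caseNat h _ h' => exact .iota_succ _ (hd _ h) (hb _ h')
      | iota_zero _ h _ => cases hd _ h
      | iota_succ _ h h' => cases hd _ h with | succ h => exact .app (hb _ h') h
    · refine ⟨.caseNat d a b, fun w h => ?_⟩
      cases h with
      | caseNat h h' h'' => exact .caseNat (hd _ h) (ha _ h') (hb _ h'')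
      | iota_zero _ h _ => cases hd _ h; exact absurd rfl h₁
      | iota_succ _ h _ => cases hd _ h; exact absurd ⟨_, rfl⟩ h₂
  | caseList t u v iht ihu ihv =>
    obtain ⟨d, hd⟩ := iht
    obtain ⟨a, ha⟩ := ihu
    obtain ⟨b, hb⟩ := ihv
    by_cases h₁ : d = .nil
    · subst h₁
      refine ⟨a, fun w h => ?_⟩
      cases h with
      | caseList h h' _ => exact .iota_nil _ (hd _ h) (ha _ h')
      | iota_nil _ _ h => exact ha _ h
      | iota_cons _ h _ => cases hd _ h
    by_cases h₂ : ∃ x l, d = .cons x l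
    · obtain ⟨x, l, rfl⟩ := h₂
      refine ⟨.app (.app b x) l, fun w h => ?_⟩
      cases h with
      | caseList h _ h' => exact .iota_cons _ (hd _ h) (hb _ h')
      | iota_nil _ h _ => cases hd _ h
      | iota_cons _ h h' =>
        cases hd _ h with | cons h h'' => exact .app (.app (hb _ h') h) h''
    · refine ⟨.caseList d a b, fun w h => ?_⟩
      cases h with
      | caseList h h' h'' => exact .caseList (hd _ h) (ha _ h') (hb _ h'')
      | iota_nil _ h _ => cases hd _ h; exact absurd rfl h₁
      | iota_cons _ h _ => cases hd _ h; exact absurd ⟨_, _, rfl⟩ h₂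

/-- Only this inclusion is needed: joinability is an equivalence relation, and preservation of
meaning is proved for `Par` directly, so parallel steps never have to be decomposed into single
ones. -/
theorem Step.par {Γ : Ctx} {τ : Ty} {t t' : Tm Γ τ} (h : Step t t') : Par t t' := by
  induction h with
  | beta t u => exact .beta (.refl _) (.refl _)
  | beta_fst t u => exact .beta_fst (.refl _)
  | beta_snd t u => exact .beta_snd (.refl _)
  | iota_tt u v => exact .iota_tt _ (.refl _) (.refl _)
  | iota_ff u v => exact .iota_ff _ (.refl _) (.refl _)
  | iota_zero u v => exact .iota_zero _ (.refl _) (.refl _)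
  | iota_succ t u v => exact .iota_succ _ (.refl _) (.refl _)
  | iota_nil u v => exact .iota_nil _ (.refl _) (.refl _)
  | iota_cons h t u v => exact .iota_cons _ (.refl _) (.refl _)
  | mu hι e c hc => exact .mu (.refl _) (.refl _) hc
  | _ => constructor <;> first | assumption | exact .refl _

open Relation in
/-- Convertible terms have a common reduct. -/
theorem Conv.join {Γ : Ctx} {τ : Ty} {t t' : Tm Γ τ} (h : Conv t t') :
    Join (ReflTransGen Par) t t' := by
  -- The development depends on `a` alone, so it closes every fork starting at `a` with one step on
  -- each side.
  have hd : ∀ a b c : Tm Γ τ, Par a b → Par a c → ∃ d, ReflGen Par b d ∧ ReflTransGen Par c d := by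
    intro a b c hb hc
    obtain ⟨d, hd⟩ := Par.exists_development a
    exact ⟨d, .single (hd _ hb), .single (hd _ hc)⟩
  have he := equivalence_join_reflTransGen hd
  -- Joinability contains reduction and is an equivalence relation by confluence, so it contains
  -- conversion.
  induction h with
  | rel _ _ h => exact ⟨_, .single h.par, .refl⟩
  | refl => exact he.refl _
  | symm _ _ _ ih => exact he.symm ih
  | trans _ _ _ _ _ ih ih' => exact he.trans ih ih'

/-! ### Reduction preserves the interpretation of legal terms -/

theorem uniqueFix_eq {A : Type} {τ : Ty} {G : (A → τ.Den) → A → τ.Den}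
    (h : ∃! F : A → τ.Den, ∀ v, F v = G F v) (v : A) : uniqueFix G v = G (uniqueFix G) v := by
  rw [uniqueFix, dif_pos h]
  exact h.choose_spec.1 v

/-- `WellDef` guarantees a unique solution, so the default branch of `uniqueFix` is not taken. The
equation holds at every argument, constructor or not. -/
theorem WellDef.den_letrec {Γ : Ctx} {ι σ : Ty} (hι : IsInd ι) {e : Tm (ι :: .arr ι σ :: Γ) σ}
    (h : WellDef e) (ρ : Env Γ) (v : ι.Den) :
    (Tm.letrec hι e).den ρ v =
      e.den (Env.cons v (Env.cons (σ := .arr ι σ) ((Tm.letrec hι e).den ρ) ρ)) :=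
  uniqueFix_eq (h.existsUnique_fix ρ) v

theorem TmSub.den_cons {Γ Δ : Ctx} {σ : Ty} (t : Tm Δ σ) (θ : TmSub Γ Δ) (ρ : Env Δ) :
    (fun τ x => (TmSub.cons t θ τ x).den ρ) =
      Env.cons (t.den ρ) fun τ x => (θ τ x).den ρ := by
  funext τ x
  cases x <;> rfl

theorem TmSub.cons_legal {Γ Δ : Ctx} {σ : Ty} {t : Tm Δ σ} {θ : TmSub Γ Δ} (ht : t.Legal)
    (hθ : ∀ τ x, (θ τ x).Legal) : ∀ τ x, (TmSub.cons t θ τ x).Legal := by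
  intro τ x
  cases x with
  | z => exact ht
  | s y => exact hθ _ y

theorem TmSub.id_legal {Γ : Ctx} : ∀ τ x, (TmSub.id (Γ := Γ) τ x).Legal := fun _ _ => trivial

theorem TmSub.den_id {Γ : Ctx} (ρ : Env Γ) : (fun τ x => (TmSub.id τ x).den ρ) = ρ := rfl

/-- Legality and value must be carried through one induction. Contracting a `mu` redex preserves the
value only because the `letrec` reached is legal; conversely, `WellDef` is a condition on the values
of a body, so it passes to the reduced body because the values agree under all valuations. -/
theorem Par.legal_den {Γ : Ctx} {τ : Ty} {t t' : Tm Γ τ} (h : Par t t') :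
    t.Legal → t'.Legal ∧ ∀ ρ, t.den ρ = t'.den ρ := by
  induction h with
  | letrec _ _ ih =>
    rintro ⟨hw, he⟩
    obtain ⟨hl, hden⟩ := ih he
    refine ⟨⟨?_, hl⟩, fun ρ => ?_⟩
    · intro ρ v g g' hg
      -- Agreement is used in the extended valuations of the body, for both functions `g` and `g'`.
      rw [← hden, ← hden]
      exact hw ρ v g g' hg
    · simp only [Tm.den, hden]
  | beta _ _ ih₁ ih₂ =>
    rintro ⟨ht, hu⟩
    obtain ⟨hb, hbd⟩ := ih₁ ht
    obtain ⟨hu', hud⟩ := ih₂ hu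
    refine ⟨Tm.Legal.subst _ _ (TmSub.cons_legal hu' TmSub.id_legal) hb, fun ρ => ?_⟩
    rw [Tm.den_subst, TmSub.den_cons, TmSub.den_id, Tm.den, hbd, hud]
    rfl
  | @mu _ _ _ hι _ _ _ _ _ _ _ ih₁ ih₂ =>
    rintro ⟨ht, hu⟩
    obtain ⟨hl, hld⟩ := ih₁ ht
    obtain ⟨hc, hcd⟩ := ih₂ hu
    refine ⟨Tm.Legal.subst _ _ (TmSub.cons_legal hc (TmSub.cons_legal hl TmSub.id_legal)) hl.2,
      fun ρ => ?_⟩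
    rw [Tm.den_subst, TmSub.den_cons, TmSub.den_cons, TmSub.den_id, Tm.den, hld, hcd]
    exact hl.1.den_letrec hι ρ _
  | _ => simp_all [Tm.Legal, Tm.den]

/-- Convertible legal terms have the same interpretation, even though a conversion between
them may pass through terms that are not legal. -/
theorem Conv.den_eq {Γ : Ctx} {τ : Ty} {t t' : Tm Γ τ} (h : Conv t t') (ht : t.Legal)
    (ht' : t'.Legal) (ρ : Env Γ) : t.den ρ = t'.den ρ := by
  -- Legality is transported forwards only, from each legal endpoint down to the common reduct.
  have key : ∀ {u w : Tm Γ τ}, Relation.ReflTransGen Par u w → u.Legal →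
      w.Legal ∧ u.den ρ = w.den ρ := by
    intro u w h hu
    induction h with
    | refl => exact ⟨hu, rfl⟩
    | tail _ h ih =>
      obtain ⟨hl, hd⟩ := h.legal_den ih.1
      exact ⟨hl, ih.2.trans (hd ρ)⟩
  obtain ⟨w, h₁, h₂⟩ := h.join
  exact (key h₁ ht).2.trans (key h₂ ht').2.symm

/-! ### Semantics of substitution in assertions -/

/-- The valuation obtained by interpreting the terms of a substitution. -/
noncomputable def Sub.den {Γ Δ : Ctx} (θ : Sub Γ Δ) (ρ : Env Δ) : Env Γ :=
  fun τ x => (θ τ x).den ρ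

theorem Sub.den_cons {Γ Δ : Ctx} {σ : Ty} (t : Term Δ σ) (θ : Sub Γ Δ) (ρ : Env Δ) :
    (t ▹ θ).den ρ = Env.cons (t.den ρ) (θ.den ρ) := by
  funext τ x
  cases x <;> rfl

theorem Term.den_subst {Γ Δ : Ctx} {τ : Ty} (t : Term Γ τ) (θ : Sub Γ Δ) (ρ : Env Δ) :
    (t.subst θ).den ρ = t.den (θ.den ρ) :=
  Tm.den_subst _ _ _

theorem Sub.den_lift {Γ Δ : Ctx} {σ : Ty} (θ : Sub Γ Δ) (v : σ.Den) (ρ : Env Δ) :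
    θ.lift.den (Env.cons v ρ) = Env.cons v (θ.den ρ) := by
  funext τ x
  cases x with
  | z => rfl
  | s y => exact Term.den_subst (θ τ y) w1 (Env.cons v ρ)

/-- Substituting in an assertion amounts to changing the valuation; the quantifier cases rest on
`Sub.den_lift`. Every side condition in the rules is evaluated through this lemma. -/
theorem Form.holds_subst {S : Signature.{u}} (M : Interp S) {Γ : Ctx} (φ : Form S Γ) :
    ∀ {Δ : Ctx} (θ : Sub Γ Δ) (ρ : Env Δ), (φ.subst θ).Holds M ρ ↔ φ.Holds M (θ.den ρ) := by
  induction φ <;> intro Δ θ ρ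
  case pred P ts =>
    simp only [Form.subst, Form.Holds, Term.den_subst]
  all_goals simp_all [Form.subst, Form.Holds, Term.den_subst, Sub.den_lift]

/-! ### Values of weakenings, variables and term constructors. -/

section Den

variable {Γ : Ctx} {σ τ a b c d e f : Ty}

theorem Sub.den_w0 (ρ : Env Γ) : w0.den ρ = ρ := rfl
theorem Sub.den_w1 (x : a.Den) (ρ : Env Γ) : w1.den (Env.cons x ρ) = ρ := rfl
theorem Sub.den_w2 (x : a.Den) (y : b.Den) (ρ : Env Γ) :
    w2.den (Env.cons x (Env.cons y ρ)) = ρ := rfl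
theorem Sub.den_w3 (x : a.Den) (y : b.Den) (z : c.Den) (ρ : Env Γ) :
    w3.den (Env.cons x (Env.cons y (Env.cons z ρ))) = ρ := rfl
theorem Sub.den_w4 (x : a.Den) (y : b.Den) (z : c.Den) (x' : d.Den) (ρ : Env Γ) :
    w4.den (Env.cons x (Env.cons y (Env.cons z (Env.cons x' ρ)))) = ρ := rfl
theorem Sub.den_w5 (x : a.Den) (y : b.Den) (z : c.Den) (x' : d.Den) (y' : e.Den) (ρ : Env Γ) :
    w5.den (Env.cons x (Env.cons y (Env.cons z (Env.cons x' (Env.cons y' ρ))))) = ρ := rfl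
theorem Sub.den_w6 (x : a.Den) (y : b.Den) (z : c.Den) (x' : d.Den) (y' : e.Den) (z' : f.Den)
    (ρ : Env Γ) :
    w6.den (Env.cons x (Env.cons y (Env.cons z (Env.cons x' (Env.cons y' (Env.cons z' ρ)))))) =
      ρ := rfl

theorem Term.den_v0 (x : a.Den) (ρ : Env Γ) : v0.den (Env.cons x ρ) = x := rfl
theorem Term.den_v1 (x : a.Den) (y : b.Den) (ρ : Env Γ) :
    v1.den (Env.cons x (Env.cons y ρ)) = y := rfl
theorem Term.den_v2 (x : a.Den) (y : b.Den) (z : c.Den) (ρ : Env Γ) :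
    v2.den (Env.cons x (Env.cons y (Env.cons z ρ))) = z := rfl
theorem Term.den_v3 (x : a.Den) (y : b.Den) (z : c.Den) (x' : d.Den) (ρ : Env Γ) :
    v3.den (Env.cons x (Env.cons y (Env.cons z (Env.cons x' ρ)))) = x' := rfl
theorem Term.den_v4 (x : a.Den) (y : b.Den) (z : c.Den) (x' : d.Den) (y' : e.Den) (ρ : Env Γ) :
    v4.den (Env.cons x (Env.cons y (Env.cons z (Env.cons x' (Env.cons y' ρ))))) = y' := rfl
theorem Term.den_v5 (x : a.Den) (y : b.Den) (z : c.Den) (x' : d.Den) (y' : e.Den) (z' : f.Den)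
    (ρ : Env Γ) :
    v5.den (Env.cons x (Env.cons y (Env.cons z (Env.cons x' (Env.cons y' (Env.cons z' ρ)))))) =
      z' := rfl

variable (ρ : Env Γ)

theorem Term.den_var (x : Var Γ τ) : (Term.var x).den ρ = ρ τ x := rfl
theorem Term.den_pair (t : Term Γ σ) (u : Term Γ τ) :
    (Term.pair t u).den ρ = (t.den ρ, u.den ρ) := rfl
theorem Term.den_fst (t : Term Γ (.prod σ τ)) : (Term.fst t).den ρ = (t.den ρ).1 := rfl
theorem Term.den_snd (t : Term Γ (.prod σ τ)) : (Term.snd t).den ρ = (t.den ρ).2 := rfl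
theorem Term.den_app (t : Term Γ (.arr σ τ)) (u : Term Γ σ) :
    (Term.app t u).den ρ = t.den ρ (u.den ρ) := rfl
theorem Term.den_lam (t : Term (σ :: Γ) τ) (v : σ.Den) :
    (Term.lam t).den ρ v = t.den (Env.cons v ρ) := rfl
theorem Term.den_tt : (Term.tt : Term Γ _).den ρ = true := rfl
theorem Term.den_ff : (Term.ff : Term Γ _).den ρ = false := rfl
theorem Term.den_zero : (Term.zero : Term Γ _).den ρ = (0 : ℕ) := rfl
theorem Term.den_succ (t : Term Γ .nat) : (Term.succ t).den ρ = Nat.succ (t.den ρ) := rfl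
theorem Term.den_nil : (Term.nil : Term Γ (.list τ)).den ρ = ([] : List τ.Den) := rfl
theorem Term.den_cons (t : Term Γ τ) (u : Term Γ (.list τ)) :
    (Term.cons t u).den ρ = (t.den ρ :: u.den ρ : List τ.Den) := rfl

theorem Term.den_caseBool (t : Term Γ .bool) (u v : Term Γ σ) :
    (Term.caseBool t u v).den ρ =
      match t.den ρ with
      | true => u.den ρ
      | false => v.den ρ := rfl
theorem Term.den_caseNat (t : Term Γ .nat) (u : Term Γ σ) (v : Term Γ (.arr .nat σ)) :
    (Term.caseNat t u v).den ρ =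
      match t.den ρ with
      | Nat.zero => u.den ρ
      | Nat.succ n => v.den ρ n := rfl
theorem Term.den_caseList (t : Term Γ (.list τ)) (u : Term Γ σ)
    (v : Term Γ (.arr τ (.arr (.list τ) σ))) :
    (Term.caseList t u v).den ρ =
      match t.den ρ with
      | [] => u.den ρ
      | x :: l => v.den ρ x l := rfl

/-- Kept out of the simplification set below: the right side mentions the recursive function again,
so it is unfolded by hand, once per recursive definition. -/
theorem Term.den_letrec (hι : IsInd a) {e : Term (a :: .arr a σ :: Γ) σ} (he : WellDef e.1)
    (v : a.Den) :
    (Term.letrec hι e he).den ρ v =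
      e.den (Env.cons v (Env.cons (σ := .arr a σ) ((Term.letrec hι e he).den ρ) ρ)) :=
  he.den_letrec hι ρ v

end Den

/-! ### Entailment -/

/-- All assertions of `Ψ` hold under `ρ`. -/
def Sat {S : Signature.{u}} (M : Interp S) {Γ : Ctx} (Ψ : Set (Form S Γ)) (ρ : Env Γ) : Prop :=
  ∀ ψ ∈ Ψ, ψ.Holds M ρ

section Sat

variable {S : Signature.{u}} (M : Interp S) {Γ : Ctx} {a b c d : Ty} (Ψ : Set (Form S Γ))

theorem sat_insert (ψ : Form S Γ) (ρ : Env Γ) :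
    Sat M (insert ψ Ψ) ρ ↔ ψ.Holds M ρ ∧ Sat M Ψ ρ := by
  simp only [Sat, Set.mem_insert_iff, forall_eq_or_imp]

theorem sat_wk1 (x : a.Den) (ρ : Env Γ) : Sat M (wk1 Ψ) (Env.cons x ρ) ↔ Sat M Ψ ρ := by
  simp only [Sat, wk1, Set.forall_mem_image, Form.holds_subst, Sub.den_w1]

theorem sat_wk2 (x : a.Den) (y : b.Den) (ρ : Env Γ) :
    Sat M (wk2 Ψ) (Env.cons x (Env.cons y ρ)) ↔ Sat M Ψ ρ := by
  simp only [Sat, wk2, Set.forall_mem_image, Form.holds_subst, Sub.den_w2]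

theorem sat_wk4 (x : a.Den) (y : b.Den) (z : c.Den) (x' : d.Den) (ρ : Env Γ) :
    Sat M (wk4 Ψ) (Env.cons x (Env.cons y (Env.cons z (Env.cons x' ρ)))) ↔ Sat M Ψ ρ := by
  simp only [Sat, wk4, Set.forall_mem_image, Form.holds_subst, Sub.den_w4]

end Sat

-- Soundness of HOL, UHOL and RHOL.

attribute [local simp] Form.Holds Form.holds_subst Sub.den_cons Term.den_subst
  Sub.den_w0 Sub.den_w1 Sub.den_w2 Sub.den_w3 Sub.den_w4 Sub.den_w5 Sub.den_w6
  Term.den_v0 Term.den_v1 Term.den_v2 Term.den_v3 Term.den_v4 Term.den_v5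
  Term.den_var Term.den_pair Term.den_fst Term.den_snd Term.den_app Term.den_lam Term.den_tt
  Term.den_ff Term.den_zero Term.den_succ Term.den_nil Term.den_cons
  Term.den_caseBool Term.den_caseNat Term.den_caseList
  sat_insert sat_wk1 sat_wk2 sat_wk4 Form.iff Form.ne Form.sizeLt₂ Form.arrow Form.natBranch
  Form.listBranch Form.arrow₂ Form.arrowL Form.arrowR Form.natBranchL Form.natBranchR
  Form.listBranchL Form.listBranchR Form.natNatBranch Form.natListBranch Form.listNatBranch
  Form.listListBranch

/-- Set-theoretical soundness of HOL. -/
theorem HOL.sound {S : Signature.{u}} {Ax : Set (Form S [])} {M : Interp S} (hM : M.Models Ax)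
    {Γ : Ctx} {Ψ : Set (Form S Γ)} {φ : Form S Γ} (h : HOL Ax Ψ φ) :
    ∀ ρ : Env Γ, Sat M Ψ ρ → φ.Holds M ρ := by
  induction h <;> intro ρ hρ
  case ax h => exact hρ _ h
  case predAx α hα =>
    rw [Form.holds_subst]
    have : Sub.closed.den ρ = Env.nil := by
      funext τ x
      cases x
    rw [this]
    exact hM α hα
  -- Only the two endpoints are known to be legal, which is all that `Conv.den_eq` requires.
  case conv t t' h => exact h.den_eq t.2 t'.2 ρ
  case ex_i t _ ih => exact ⟨t.den ρ, by simpa using ih ρ hρ⟩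
  case ex_e ih₁ ih₂ =>
    obtain ⟨v, hv⟩ := ih₁ ρ hρ
    have := ih₂ (Env.cons v ρ)
    simp_all
  case or_e ih ih₁ ih₂ =>
    rcases ih ρ hρ with h | h
    · exact ih₁ ρ (by simpa using ⟨h, hρ⟩)
    · exact ih₂ ρ (by simpa using ⟨h, hρ⟩)
  case bool_ind ih₁ ih₂ =>
    intro v
    have := ih₁ ρ hρ
    have := ih₂ ρ hρ
    cases v <;> simp_all
  case nat_ind ih₁ ih₂ =>
    intro v
    induction v with
    | zero => simpa using ih₁ ρ hρ
    | succ n ih => simpa using ih₂ (Env.cons (σ := .nat) n ρ) (by simpa using ⟨ih, hρ⟩)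
  case list_ind τ φ _ _ ih₁ ih₂ =>
    intro v
    induction v with
    | nil => simpa using ih₁ ρ hρ
    | cons x l ih =>
      simpa using ih₂ (Env.cons (σ := .list τ) l (Env.cons x ρ)) (by simpa using ⟨ih, hρ⟩)
  case strong_ind ι hι φ _ ih =>
    intro v
    -- Sizes are natural numbers, so the induction runs on the size, for all values of that size at
    -- once.
    induction hn : ι.size v using Nat.strong_induction_on generalizing v with
    | _ n hi =>
      subst hn
      refine ih _ ?_
      simp only [sat_insert, sat_wk1]
      refine ⟨fun m hm => ?_, hρ⟩
      simpa using hi _ hm m rfl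
  -- For the remaining rules, evaluating the assertions leaves only ordinary logical steps and the
  -- disjointness and injectivity of constructors.
  all_goals simp_all

/-- Set-theoretical soundness of UHOL. -/
theorem UHOL.sound {S : Signature.{u}} {Ax : Set (Form S [])} {M : Interp S} (hM : M.Models Ax)
    {Γ : Ctx} {τ : Ty} {Ψ : Set (Form S Γ)} {t : Term Γ τ} {φ : Form S (τ :: Γ)}
    (h : UHOL Ax Ψ t φ) :
    ∀ ρ : Env Γ, Sat M Ψ ρ → φ.Holds M (Env.cons (t.den ρ) ρ) := by
  induction h <;> intro ρ hρ
  case boolcase t _ _ _ _ _ ih₁ ih₂ | natcase t _ _ _ _ _ ih₁ ih₂ | listcase t _ _ _ _ _ ih₁ ih₂ =>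
    have ih₁ := ih₁ ρ
    have ih₂ := ih₂ ρ
    -- The value of the scrutinee selects the branch and makes the guard of the matching premise
    -- true; its components instantiate the quantifiers of that premise.
    cases h : t.den ρ <;> simp_all
  case letrec ι σ Ψ hι e he φ' φ _ ih =>
    simp only [Form.arrow, Form.Holds]
    intro v
    induction hn : ι.size v using Nat.strong_induction_on generalizing v with
    | _ n hi =>
      subst hn
      simp
      intro hφ'
      rw [Term.den_letrec]
      -- The variable `f` is given the recursive function itself, so the premise's assumption about
      -- `f` at smaller arguments is the induction hypothesis, and the value of the body is the
      -- value of the function at `v`.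
      have := ih (Env.cons v (Env.cons (σ := .arr ι _) ((Term.letrec hι e he).den ρ) ρ))
      simp at this
      refine this ?_ hφ' hρ
      intro m hm
      simpa using hi _ hm m rfl
  case var h => have := h.sound hM ρ hρ; simp_all
  case abs ih =>
    simp
    intro v hv
    exact ih _ (by simp; exact ⟨hv, hρ⟩)
  case app ih₁ ih₂ =>
    have := ih₁ ρ hρ
    have := ih₂ ρ hρ
    simp_all
  case tt h => have := h.sound hM ρ hρ; simp_all
  case ff h => have := h.sound hM ρ hρ; simp_all
  case zero h => have := h.sound hM ρ hρ; simp_all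
  case nil h => have := h.sound hM ρ hρ; simp_all
  case succ h ih => have := h.sound hM ρ hρ; simp_all
  case cons h ih₁ ih₂ => have := h.sound hM ρ hρ; simp_all
  case pair h ih₁ ih₂ => have := h.sound hM ρ hρ; simp_all
  case sub h ih => have := h.sound hM ρ hρ; simp_all
  case proj₁ ih => have := ih ρ hρ; simp_all
  case proj₂ ih => have := ih ρ hρ; simp_all

set_option maxHeartbeats 2000000 in
/-- Set-theoretical soundness of RHOL. -/
theorem RHOL.sound {S : Signature.{u}} {Ax : Set (Form S [])} {M : Interp S} (hM : M.Models Ax)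
    {Γ : Ctx} {σ₁ σ₂ : Ty} {Ψ : Set (Form S Γ)} {t₁ : Term Γ σ₁} {t₂ : Term Γ σ₂}
    {φ : Form S (σ₁ :: σ₂ :: Γ)} (h : RHOL Ax Ψ t₁ t₂ φ) :
    ∀ ρ : Env Γ, Sat M Ψ ρ → φ.Holds M (Env.cons (t₁.den ρ) (Env.cons (t₂.den ρ) ρ)) := by
  induction h <;> intro ρ hρ
  case boolcaseL t₁ _ _ _ _ _ _ ih₁ ih₂
    | natcaseL t₁ _ _ _ _ _ _ ih₁ ih₂
    | listcaseL t₁ _ _ _ _ _ _ ih₁ ih₂ =>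
    have ih₁ := ih₁ ρ
    have ih₂ := ih₂ ρ
    cases h : t₁.den ρ <;> simp_all
  case boolcaseR t₂ _ _ _ _ _ ih₁ ih₂
    | natcaseR t₂ _ _ _ _ _ ih₁ ih₂
    | listcaseR t₂ _ _ _ _ _ ih₁ ih₂ =>
    have ih₁ := ih₁ ρ
    have ih₂ := ih₂ ρ
    cases h : t₂.den ρ <;> simp_all
  case boolcase t₁ t₂ _ _ _ _ _ _ _ _ ih ih₁ ih₂
    | natcase t₁ t₂ _ _ _ _ _ _ _ _ ih ih₁ ih₂
    | listcase t₁ t₂ _ _ _ _ _ _ _ _ ih ih₁ ih₂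
    | natcaseStar t₁ t₂ _ _ _ _ _ _ _ _ _ ih ih₁ ih₂
    | listcaseStar t₁ t₂ _ _ _ _ _ _ _ _ _ ih ih₁ ih₂ =>
    have ih := ih ρ
    have ih₁ := ih₁ ρ
    have ih₂ := ih₂ ρ
    -- Mixed constructors contradict the synchrony premise `ih`; the two matching combinations are
    -- the two branch premises.
    cases h₁ : t₁.den ρ <;> cases h₂ : t₂.den ρ <;> simp_all
  case bbcaseA t₁ t₂ _ _ _ _ _ _ _ _ _ _ _ ih₁ ih₂ ih₃ ih₄
    | bncaseA t₁ t₂ _ _ _ _ _ _ _ _ _ _ _ ih₁ ih₂ ih₃ ih₄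
    | blcaseA t₁ t₂ _ _ _ _ _ _ _ _ _ _ _ ih₁ ih₂ ih₃ ih₄
    | nbcaseA t₁ t₂ _ _ _ _ _ _ _ _ _ _ _ ih₁ ih₂ ih₃ ih₄
    | nncaseA t₁ t₂ _ _ _ _ _ _ _ _ _ _ _ ih₁ ih₂ ih₃ ih₄
    | nlcaseA t₁ t₂ _ _ _ _ _ _ _ _ _ _ _ ih₁ ih₂ ih₃ ih₄
    | lbcaseA t₁ t₂ _ _ _ _ _ _ _ _ _ _ _ ih₁ ih₂ ih₃ ih₄
    | lncaseA t₁ t₂ _ _ _ _ _ _ _ _ _ _ _ ih₁ ih₂ ih₃ ih₄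
    | llcaseA t₁ t₂ _ _ _ _ _ _ _ _ _ _ _ ih₁ ih₂ ih₃ ih₄ =>
    have ih₁ := ih₁ ρ
    have ih₂ := ih₂ ρ
    have ih₃ := ih₃ ρ
    have ih₄ := ih₄ ρ
    -- Each of the four combinations of constructors has its own premise. For a boolean, being
    -- different from `tt` covers the value `false`.
    cases h₁ : t₁.den ρ <;> cases h₂ : t₂.den ρ <;> simp_all
  -- In the two cases that fall back to UHOL, the term put in place of the other distinguished
  -- variable is weakened past `r`, so its value is unchanged.
  case var h | tt h | ff h | zero h | nil h | ttL h | ffL h | zeroL h | nilL h | ttR h | ffR h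
    | zeroR h | nilR h | uholL h | uholR h =>
    have := h.sound hM ρ hρ
    simp_all
  case succ h ih | succL h ih | succR h ih | sub h ih | appL h ih | appR h ih =>
    have := h.sound hM ρ hρ
    have := ih ρ hρ
    simp_all
  case cons h ih₁ ih₂ | pair h ih₁ ih₂ | consL h ih₁ ih₂ | pairL h ih₁ ih₂ | consR h ih₁ ih₂
    | pairR h ih₁ ih₂ =>
    have := h.sound hM ρ hρ
    have := ih₁ ρ hρ
    have := ih₂ ρ hρ
    simp_all
  case proj₁ ih | proj₂ ih | proj₁L ih | proj₂L ih | proj₁R ih | proj₂R ih =>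
    have := ih ρ hρ
    simp_all
  case varL h | varR h =>
    have := hρ _ h
    simp_all
  case app ih₁ ih₂ =>
    have := ih₁ ρ hρ
    have := ih₂ ρ hρ
    simp_all
  case and_i ih₁ ih₂ => exact ⟨ih₁ ρ hρ, ih₂ ρ hρ⟩
  case imp_i ih => have := ih ρ; simp_all
  case abs ih =>
    simp
    intro v₁ v₂ hv
    -- Both arguments are in scope at once; the shifts in the premise make each body see only its
    -- own argument.
    have := ih (Env.cons v₁ (Env.cons v₂ ρ))
    simp_all
  case absL ih =>
    simp
    intro v hv
    have := ih (Env.cons v ρ)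
    simp_all
  case absR ih =>
    simp
    intro v hv
    have := ih (Env.cons v ρ)
    simp_all
  case letrec ι₁ ι₂ σ₁ σ₂ Ψ h₁ h₂ e₁ e₂ he₁ he₂ φ' φ _ ih =>
    simp only [Form.arrow₂, Form.Holds]
    intro v₁ v₂
    -- The sum of the sizes decreases along the product order: neither component grows and one of
    -- them strictly shrinks.
    induction hn : ι₁.size v₁ + ι₂.size v₂ using Nat.strong_induction_on
      generalizing v₁ v₂ with
    | _ n hi =>
      subst hn
      simp
      intro hφ'
      rw [Term.den_letrec, Term.den_letrec]
      -- Both function variables are interpreted by the recursive functions themselves, in the order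
      -- `x₁`, `x₂`, `f₁`, `f₂` of the premise.
      have := ih (Env.cons v₁ (Env.cons v₂
        (Env.cons (σ := .arr ι₁ σ₁) ((Term.letrec h₁ e₁ he₁).den ρ)
          (Env.cons (σ := .arr ι₂ σ₂) ((Term.letrec h₂ e₂ he₂).den ρ) ρ))))
      simp at this
      refine this ?_ hφ' hρ
      intro m₁ m₂ hle₁ hle₂ hlt
      simpa using hi _ (by omega) m₁ m₂ rfl
  case letrecL ι σ₁ σ₂ Ψ hι e he t₂ φ' φ _ ih =>
    simp only [Form.arrowL, Form.Holds]
    intro v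
    induction hn : ι.size v using Nat.strong_induction_on generalizing v with
    | _ n hi =>
      subst hn
      simp
      intro hφ'
      rw [Term.den_letrec]
      -- The right-hand term does not depend on the new variables, so its value stays fixed while
      -- the induction descends on the left argument alone.
      have := ih (Env.cons v (Env.cons (σ := .arr ι σ₁) ((Term.letrec hι e he).den ρ) ρ))
      simp at this
      refine this ?_ hφ' hρ
      intro m hm
      simpa using hi _ hm m rfl
  case letrecR ι σ₁ σ₂ Ψ hι t₁ e he φ' φ _ ih =>
    simp only [Form.arrowR, Form.Holds]
    intro v
    induction hn : ι.size v using Nat.strong_induction_on generalizing v with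
    | _ n hi =>
      subst hn
      simp
      intro hφ'
      rw [Term.den_letrec]
      have := ih (Env.cons v (Env.cons (σ := .arr ι σ₂) ((Term.letrec hι e he).den ρ) ρ))
      simp at this
      refine this ?_ hφ' hρ
      intro m hm
      simpa using hi _ hm m rfl

end RelHOL

theorem mainTheorem3 {S : RelHOL.Signature.{u}} (Ax : Set (RelHOL.Form S []))
    (M : RelHOL.Interp S) (hM : M.Models Ax) :
    (∀ (Γ : RelHOL.Ctx) (σ₁ σ₂ : RelHOL.Ty) (Ψ : Set (RelHOL.Form S Γ))
      (t₁ : RelHOL.Term Γ σ₁) (t₂ : RelHOL.Term Γ σ₂) (φ : RelHOL.Form S (σ₁ :: σ₂ :: Γ)),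
      RelHOL.RHOL Ax Ψ t₁ t₂ φ →
        ∀ ρ : RelHOL.Env Γ, (∀ ψ ∈ Ψ, ψ.Holds M ρ) →
          φ.Holds M (RelHOL.Env.cons (t₁.den ρ) (RelHOL.Env.cons (t₂.den ρ) ρ))) ∧
    (∀ (Γ : RelHOL.Ctx) (σ₁ σ₂ : RelHOL.Ty) (t₁ : RelHOL.Term Γ σ₁) (t₂ : RelHOL.Term Γ σ₂),
      ¬ RelHOL.RHOL Ax ∅ t₁ t₂ RelHOL.Form.bot) :=
  ⟨fun _ _ _ _ _ _ _ h ρ hρ => h.sound hM ρ hρ,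
    -- For consistency, default elements give a valuation of any context, and the empty set of
    -- assertions holds under it; soundness would then make `bot` true.
    fun _ _ _ _ _ h => h.sound hM (fun τ _ => τ.someDen) fun _ hψ => hψ.elim⟩
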